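/- Let $d\ge 1$ be an integer, let $\gamma_1,\gamma_2,\gamma_3>0$, and let $1\le p<\frac{d+2}{d}$. For $r>0$ let $B_r(x_0)$ be the open Euclidean ball in $\mathbb{R}^d$ of radius $r$ centred at $x_0$, let $B_r=B_r(0)$, and let $Q_r=(-r^2,0)\times B_r\subset\mathbb{R}\times\mathbb{R}^d$. Write $a_+=\max(a,0)$. A function $u:Q_2\to\mathbb{R}$ belongs to the De Giorgi sub-class $DG^+(\gamma_1,\gamma_2,\gamma_3,p)$ on $Q_2$ if $u\in L^\infty((-4,0);L^2(B_2))$, its weak spatial gradient $\nabla_x u$ is in $L^2(Q_2)$, and for all $k\in\mathbb{R}$, all $0<r<R$, all $x_0\in B_2$ with $B_R(x_0)\subset B_2$, and almost all times $s<t$ in $(-4,0)$, $$\int_{B_r(x_0)}(u-k)_+^2(t,x)\,dx+\gamma_1\int_s^t\int_{B_r(x_0)}|\nabla_x(u-k)_+(\tau,x)|^2\,dx\,d\tau$$ $$\le\int_{B_R(x_0)}(u-k)_+^2(s,x)\,dx+\frac{\gamma_2}{(R-r)^2}\int_s^t\int_{B_R(x_0)}(u-k)_+^2(\tau,x)\,dx\,d\tau+\gamma_3\left(\int_s^t\int_{B_R(x_0)}(u-k)_+^p(\tau,x)\,dx\,d\tau\right)^{1/p}.$$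 Then the following two statements hold. 1. There is $\delta>0$, depending only on $d,\gamma_1,\gamma_2,\gamma_3$ and $p$, such that for every $u\in DG^+(\gamma_1,\gamma_2,\gamma_3,p)$ on $Q_2$: if $\int_{Q_1}u_+^2\le\delta$, then $u_+\le\frac12$ almost everywhere in $Q_{1/2}$. 2. There is $C>0$, depending only on $d,\gamma_1,\gamma_2,\gamma_3$ and $p$, such that for every $u\in DG^+(\gamma_1,\gamma_2,\gamma_3,p)$ on $Q_2$, $$\|u_+\|_{L^\infty(Q_{1/2})}\le C\left(\|u_+\|_{L^2(Q_1)}+1\right).$$ -/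

import Mathlib

open MeasureTheory Set
open scoped ContDiff ENNReal

noncomputable section

/-- The parabolic cylinder `Q_r = (-r², 0) × B_r` in time-space `ℝ × ℝ^d`, where `B_r` is the open
Euclidean ball of radius `r` centred at the origin. -/
def parabolicCylinder (d : ℕ) (r : ℝ) : Set (ℝ × EuclideanSpace ℝ (Fin d)) :=
  Ioo (-r ^ 2) 0 ×ˢ Metric.ball 0 r

/-- `G` is the weak (distributional) gradient in the space variable of `u` on the open set `Q` of
time-space, and it is in `L²(Q)`:
`∫_Q u ∂_v φ = - ∫_Q (G · v) φ` for every `φ ∈ C_c^∞(Q)` and every direction `v` in space. -/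
structure HasL2SpatialGradient {d : ℕ} (Q : Set (ℝ × EuclideanSpace ℝ (Fin d)))
    (u : ℝ × EuclideanSpace ℝ (Fin d) → ℝ)
    (G : ℝ × EuclideanSpace ℝ (Fin d) → EuclideanSpace ℝ (Fin d)) : Prop where
  memLp : MemLp G 2 (volume.restrict Q)
  integral_eq : ∀ φ : ℝ × EuclideanSpace ℝ (Fin d) → ℝ,
    ContDiff ℝ ∞ φ → HasCompactSupport φ → tsupport φ ⊆ Q →
    ∀ v : EuclideanSpace ℝ (Fin d),
      ∫ z in Q, u z * fderiv ℝ φ z (0, v) = - ∫ z in Q, inner ℝ (G z) v * φ z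

/-- `u ∈ L^∞((T₁, T₂); L²(Ω))`, for a function `u` of `(t, x)`. -/
structure MemLinftyL2 {d : ℕ} (T₁ T₂ : ℝ) (Ω : Set (EuclideanSpace ℝ (Fin d)))
    (u : ℝ × EuclideanSpace ℝ (Fin d) → ℝ) : Prop where
  aestronglyMeasurable : AEStronglyMeasurable u (volume.restrict (Ioo T₁ T₂ ×ˢ Ω))
  bounded : ∃ M : ℝ, ∀ᵐ t ∂(volume.restrict (Ioo T₁ T₂)),
    eLpNorm (fun x => u (t, x)) 2 (volume.restrict Ω) ≤ ENNReal.ofReal M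

/-- The energy inequality of the De Giorgi sub-class, for the level `k`, the balls
`B_r(x₀) ⊆ B_R(x₀)` and the times `s < t`; `G` stands for `∇ₓ (u - k)₊`. All the integrands are
nonnegative and the integrals are taken in `[0, ∞]`. -/
def EnergyInequality {d : ℕ} (γ₁ γ₂ γ₃ p : ℝ) (u : ℝ × EuclideanSpace ℝ (Fin d) → ℝ)
    (k : ℝ) (G : ℝ × EuclideanSpace ℝ (Fin d) → EuclideanSpace ℝ (Fin d))
    (x₀ : EuclideanSpace ℝ (Fin d)) (r R s t : ℝ) : Prop :=
  (∫⁻ x in Metric.ball x₀ r, ENNReal.ofReal (max (u (t, x) - k) 0 ^ 2))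
    + ENNReal.ofReal γ₁ *
      (∫⁻ τ in Ioo s t, ∫⁻ x in Metric.ball x₀ r, ENNReal.ofReal (‖G (τ, x)‖ ^ 2))
  ≤ (∫⁻ x in Metric.ball x₀ R, ENNReal.ofReal (max (u (s, x) - k) 0 ^ 2))
    + ENNReal.ofReal (γ₂ / (R - r) ^ 2) *
      (∫⁻ τ in Ioo s t, ∫⁻ x in Metric.ball x₀ R, ENNReal.ofReal (max (u (τ, x) - k) 0 ^ 2))
    + ENNReal.ofReal γ₃ *
      (∫⁻ τ in Ioo s t, ∫⁻ x in Metric.ball x₀ R,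
        ENNReal.ofReal (max (u (τ, x) - k) 0 ^ p)) ^ (1 / p)

/-- The parabolic De Giorgi sub-class `DG⁺(γ₁, γ₂, γ₃, p)` on `(T₁, T₂) × Ω`.

A function in `L^∞((T₁, T₂); L²(Ω))` has values at almost every time only, so the energy
inequality is required at almost all times `s < t`; the class then depends only on `u` up to
null sets, and it contains every `u` satisfying the inequality at all times `s < t`.
The weak gradient of `(u - k)₊` is unique up to null sets, and it exists in `L²` because `∇ₓ u`
does (it is `∇ₓ u` on `{u > k}` and `0` elsewhere), so `∃ G` only gives it a name. -/
structure DeGiorgiSubclass {d : ℕ} (T₁ T₂ : ℝ) (Ω : Set (EuclideanSpace ℝ (Fin d)))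
    (γ₁ γ₂ γ₃ p : ℝ) (u : ℝ × EuclideanSpace ℝ (Fin d) → ℝ) : Prop where
  memLinftyL2 : MemLinftyL2 T₁ T₂ Ω u
  exists_gradient : ∃ G, HasL2SpatialGradient (Ioo T₁ T₂ ×ˢ Ω) u G
  energy : ∀ k : ℝ, ∃ G,
    HasL2SpatialGradient (Ioo T₁ T₂ ×ˢ Ω) (fun z => max (u z - k) 0) G ∧
    ∀ (r R : ℝ) (x₀ : EuclideanSpace ℝ (Fin d)), 0 < r → r < R → x₀ ∈ Ω →
      Metric.ball x₀ R ⊆ Ω →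
      ∀ᵐ s ∂(volume.restrict (Ioo T₁ T₂)), ∀ᵐ t ∂(volume.restrict (Ioo T₁ T₂)),
        s < t → EnergyInequality γ₁ γ₂ γ₃ p u k G x₀ r R s t

end

/-!
Averaging the energy inequality over its initial time gives a Caccioppoli estimate: on a smaller
cylinder the energy of `(u - k)₊` is bounded by its `L²` and `Lᵖ` integrals on a larger one.

In the other direction, `∫ |v(t, x + y) - v(t, x)|² ≤ |y|² ∫ |∇ₓ v|²`, and a function supported in
a set of measure `m` has small correlation with its translates by vectors much longer than
`m ^ (1/d)`. This is a local Faber–Krahn inequality for `(v - l)₊`, whose support is small by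
Chebyshev. Summing it over dyadic levels bounds `∫ vᵠ` by the energy for all `q < 2 + 4/d`, which
plays the role of the Sobolev embedding.

The `Lᵖ` term of the energy inequality is then of order `√E` in the energy `E`, and can be absorbed.
Hence the energy of `u₊` is bounded as soon as its `L²` norm is, and the energy of `(u - l)₊` is
small when that norm is small. De Giorgi's iteration starts from there: one step replaces `E` by a
constant times `E ^ ((1 + 2/d) / p)`, with exponent greater than one because `p < (d + 2)/d`.
The second statement follows from the first by scaling.
-/

section LowerIntegral

variable {α : Type*} [MeasurableSpace α] {μ : Measure α}

theorem sq_lintegral_le_measure_univ_mul {f : α → ℝ≥0∞} (hf : AEMeasurable f μ) :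
    (∫⁻ a, f a ∂μ) ^ 2 ≤ μ univ * ∫⁻ a, f a ^ 2 ∂μ := by
  have holder := ENNReal.lintegral_mul_le_Lp_mul_Lq μ Real.HolderConjugate.two_two hf
    (aemeasurable_const (b := (1 : ℝ≥0∞)))
  simp only [Pi.mul_apply, mul_one, ENNReal.one_rpow, lintegral_const, one_mul] at holder
  have squared := ENNReal.rpow_le_rpow holder (z := 2) (by norm_num)
  rw [ENNReal.mul_rpow_of_nonneg _ _ (by norm_num), ← ENNReal.rpow_mul, ← ENNReal.rpow_mul]
    at squared
  norm_num at squared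
  rwa [mul_comm]

theorem sq_setLIntegral_le_measure_inter_support_mul {f : α → ℝ≥0∞} (hf : Measurable f)
    (s : Set α) :
    (∫⁻ a in s, f a ∂μ) ^ 2 ≤ μ (s ∩ Function.support f) * ∫⁻ a in s, f a ^ 2 ∂μ := by
  have hsupp : MeasurableSet (Function.support f) := measurableSet_support hf
  have hrestrict : ∫⁻ a in s, f a ∂μ = ∫⁻ a in Function.support f ∩ s, f a ∂μ := by
    rw [← setLIntegral_indicator hsupp, indicator_support]
  rw [hrestrict, inter_comm]
  refine (sq_lintegral_le_measure_univ_mul hf.aemeasurable).trans ?_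
  rw [Measure.restrict_apply_univ]
  gcongr
  exact inter_subset_left

theorem ofReal_sq_eq_enorm_sq {E : Type*} [SeminormedAddCommGroup E] (x : E) :
    ENNReal.ofReal (‖x‖ ^ 2) = ‖x‖ₑ ^ 2 := by
  rw [ENNReal.ofReal_pow (norm_nonneg x), ofReal_norm]

theorem ofReal_sq_eq_enorm (x : ℝ) : ENNReal.ofReal (x ^ 2) = ‖x‖ₑ ^ 2 := by
  rw [← ofReal_sq_eq_enorm_sq, Real.norm_eq_abs, sq_abs]

theorem eLpNorm_two_sq_eq_lintegral (f : α → ℝ) :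
    eLpNorm f 2 μ ^ 2 = ∫⁻ a, ENNReal.ofReal (f a ^ 2) ∂μ := by
  simpa only [ofReal_sq_eq_enorm, ENNReal.coe_ofNat, NNReal.coe_ofNat, ENNReal.rpow_ofNat] using
    eLpNorm_nnreal_pow_eq_lintegral (μ := μ) (f := f) (p := 2) two_ne_zero

end LowerIntegral

section Time

variable {f : ℝ → ℝ≥0∞} {a b : ℝ} {M : ℝ≥0∞}

theorem exists_mem_Ioo_le_lintegral_div (hab : a < b) (hf : AEMeasurable f)
    {P : ℝ → Prop} (hP : ∀ᵐ t ∂volume.restrict (Ioo a b), P t) :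
    ∃ t ∈ Ioo a b, P t ∧ f t ≤ (∫⁻ τ in Ioo a b, f τ) / ENNReal.ofReal (b - a) := by
  have hgood : ∀ᵐ t ∂volume.restrict (Ioo a b), t ∈ Ioo a b ∧ P t :=
    (ae_restrict_mem measurableSet_Ioo).and hP
  have hne : volume.restrict (Ioo a b) ≠ 0 := by simpa [Measure.restrict_eq_zero] using hab
  obtain ⟨t, ht, hle⟩ := exists_notMem_null_le_laverage hne hf.restrict (ae_iff.1 hgood)
  obtain ⟨htab, hPt⟩ := not_not.1 ht
  refine ⟨t, htab, hPt, ?_⟩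
  rwa [setLAverage_eq, Real.volume_Ioo] at hle

theorem setLIntegral_Ioo_le_of_forall_lt (h : ∀ t < b, ∫⁻ τ in Ioo a t, f τ ≤ M) :
    ∫⁻ τ in Ioo a b, f τ ≤ M := by
  obtain ⟨t, ht_mono, ht_lt, ht_lim⟩ := exists_seq_strictMono_tendsto b
  have hunion : Ioo a b = ⋃ n, Ioo a (t n) := by
    refine Subset.antisymm (fun τ hτ => mem_iUnion.2 ?_)
      (iUnion_subset fun n => Ioo_subset_Ioo_right (ht_lt n).le)
    exact (ht_lim.eventually (lt_mem_nhds hτ.2)).exists.imp fun n hn => ⟨hτ.1, hn⟩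
  have hdir : Directed (· ⊆ ·) fun n => Ioo a (t n) :=
    Monotone.directed_le fun m n hmn => Ioo_subset_Ioo_right (ht_mono.monotone hmn)
  rw [hunion, setLIntegral_iUnion_of_directed _ hdir]
  exact iSup_le fun n => h _ (ht_lt n)

theorem setLIntegral_Ioo_le_of_ae
    (h : ∀ᵐ t ∂volume.restrict (Ioo a b), ∫⁻ τ in Ioo a t, f τ ≤ M) :
    ∫⁻ τ in Ioo a b, f τ ≤ M := by
  refine setLIntegral_Ioo_le_of_forall_lt fun t htb => ?_
  rcases le_or_gt t a with hta | hat
  · simp [Ioo_eq_empty_of_le hta]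
  · have hsub : Ioo t b ⊆ Ioo a b := Ioo_subset_Ioo_left hat.le
    obtain ⟨t', ht', hle, -⟩ := exists_mem_Ioo_le_lintegral_div htb
      (aemeasurable_const (b := (0 : ℝ≥0∞))) (ae_restrict_of_ae_restrict_of_subset hsub h)
    exact (lintegral_mono_set (Ioo_subset_Ioo_right ht'.1.le)).trans hle

end Time

theorem integral_mul_translate_sub {Z : Type*} [NormedAddCommGroup Z] [MeasurableSpace Z]
    [BorelSpace Z] {μ : Measure Z} [μ.IsAddRightInvariant] {v φ : Z → ℝ} (hv : Integrable v μ)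
    (hφ : Continuous φ) (hφc : HasCompactSupport φ) (η : Z) :
    ∫ z, φ z * (v (z + η) - v z) ∂μ = ∫ z, v z * (φ (z - η) - φ z) ∂μ := by
  obtain ⟨C, hC⟩ := hφc.exists_bound_of_continuous hφ
  have hφv : ∀ {f : Z → ℝ}, Integrable f μ → Integrable (fun z => φ z * f z) μ := fun hf =>
    hf.bdd_mul hφ.aestronglyMeasurable (.of_forall hC)
  have hvφ : Integrable (fun z => v z * φ (z - η)) μ :=
    hv.mul_bdd (c := C) (hφ.comp (by fun_prop)).aestronglyMeasurable (.of_forall fun z => hC _)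
  have hshift : ∫ z, φ z * v (z + η) ∂μ = ∫ z, v z * φ (z - η) ∂μ := by
    rw [← integral_sub_right_eq_self (fun z => φ z * v (z + η)) η]
    simp only [sub_add_cancel, mul_comm]
  simp only [mul_sub]
  rw [integral_sub (hφv (hv.comp_add_right η)) (hφv hv),
    integral_sub hvφ (by simpa only [mul_comm] using hφv hv), hshift]
  simp only [mul_comm]

section Translation

variable {Z : Type*} [NormedAddCommGroup Z] [NormedSpace ℝ Z]

theorem sub_eq_neg_integral_fderiv {φ : Z → ℝ} (hφ : ContDiff ℝ 1 φ) (z η : Z) :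
    φ (z - η) - φ z = -∫ s in Ioc (0 : ℝ) 1, fderiv ℝ φ (z - s • η) η := by
  have hderiv : ∀ s ∈ uIcc (0 : ℝ) 1,
      HasDerivAt (fun s : ℝ => φ (z - s • η)) (fderiv ℝ φ (z - s • η) (-η)) s := fun s _ => by
    have hline : HasDerivAt (fun s : ℝ => z - s • η) (-η) s := by
      simpa using ((hasDerivAt_id s).smul_const η).const_sub z
    exact (hφ.differentiable one_ne_zero (z - s • η)).hasFDerivAt.comp_hasDerivAt s hline
  have ftc := intervalIntegral.integral_eq_sub_of_hasDerivAt hderiv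
    (Continuous.intervalIntegrable (by fun_prop) _ _)
  rw [intervalIntegral.integral_of_le zero_le_one] at ftc
  simp only [map_neg, integral_neg, one_smul, zero_smul, sub_zero] at ftc
  exact ftc.symm

variable [MeasurableSpace Z] [BorelSpace Z] [SecondCountableTopology Z]
  {μ : Measure Z} [μ.IsAddRightInvariant] [SFinite μ]

theorem measurePreserving_shear (ν : Measure ℝ) [SFinite ν] (η : Z) :
    MeasurePreserving (fun q : ℝ × Z => (q.1, q.2 + q.1 • η)) (ν.prod μ) (ν.prod μ) :=
  (MeasurePreserving.id ν).skew_product (g := fun s z => z + s • η) (by fun_prop)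
    (.of_forall fun s => (measurePreserving_add_right μ (s • η)).map_eq)

theorem integrable_comp_shear {g : Z → ℝ} (hg : Integrable g μ) (ν : Measure ℝ)
    [IsFiniteMeasure ν] (η : Z) :
    Integrable (fun q : ℝ × Z => g (q.2 + q.1 • η)) (ν.prod μ) :=
  (measurePreserving_shear ν η).integrable_comp_of_integrable (hg.comp_snd ν)

theorem integral_mul_sub_eq_integral_mul_average {v g φ : Z → ℝ} (hv : Integrable v μ)
    (hg : Integrable g μ) (hφ : ContDiff ℝ ∞ φ) (hφc : HasCompactSupport φ) (η : Z)
    (h : ∀ s ∈ Ioc (0 : ℝ) 1, ∫ z, v z * fderiv ℝ φ (z - s • η) η ∂μ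
      = -∫ z, g z * φ (z - s • η) ∂μ) :
    ∫ z, v z * (φ (z - η) - φ z) ∂μ
      = ∫ z, φ z * (∫ s in Ioc (0 : ℝ) 1, g (z + s • η)) ∂μ := by
  set ν : Measure ℝ := volume.restrict (Ioc (0 : ℝ) 1)
  obtain ⟨C, hC⟩ := hφc.exists_bound_of_continuous hφ.continuous
  have hφ' : Continuous (fderiv ℝ φ) := hφ.continuous_fderiv (by simp)
  obtain ⟨C', hC'⟩ := ((hφc.fderiv ℝ).comp_left (g := fun L : Z →L[ℝ] ℝ => L η)
    (by simp)).exists_bound_of_continuous (hφ'.clm_apply continuous_const)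
  have hvφ' : Integrable (fun q : Z × ℝ => v q.1 * fderiv ℝ φ (q.1 - q.2 • η) η) (μ.prod ν) :=
    (hv.comp_fst ν).mul_bdd (c := C') (Continuous.aestronglyMeasurable (by fun_prop))
      (.of_forall fun q => hC' _)
  have hφg : Integrable (fun q : ℝ × Z => φ q.2 * g (q.2 + q.1 • η)) (ν.prod μ) :=
    (integrable_comp_shear hg ν η).bdd_mul (c := C)
      (Continuous.aestronglyMeasurable (by fun_prop)) (.of_forall fun q => hC _)
  calc ∫ z, v z * (φ (z - η) - φ z) ∂μ
      = -∫ z, ∫ s, v z * fderiv ℝ φ (z - s • η) η ∂ν ∂μ := by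
        rw [← integral_neg]
        refine integral_congr_ae (.of_forall fun z => ?_)
        simp only [sub_eq_neg_integral_fderiv (hφ.of_le (by simp)) z η, mul_neg, ν,
          integral_const_mul]
    _ = -∫ s, ∫ z, v z * fderiv ℝ φ (z - s • η) η ∂μ ∂ν := by rw [integral_integral_swap hvφ']
    _ = ∫ s, ∫ z, φ z * g (z + s • η) ∂μ ∂ν := by
        rw [← integral_neg]
        refine setIntegral_congr_fun measurableSet_Ioc fun s hs => ?_
        simp only [h s hs, neg_neg]
        rw [← integral_add_right_eq_self (fun z => g z * φ (z - s • η)) (s • η)]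
        simp only [add_sub_cancel_right, mul_comm]
    _ = ∫ z, φ z * (∫ s, g (z + s • η) ∂ν) ∂μ := by
        rw [integral_integral_swap hφg]
        simp only [integral_const_mul]

end Translation

section TranslationEstimate

variable {Z : Type*} [NormedAddCommGroup Z] [NormedSpace ℝ Z] [FiniteDimensional ℝ Z]
  [MeasurableSpace Z] [BorelSpace Z] {μ : Measure Z} [μ.IsAddHaarMeasure]

theorem translate_sub_eq_integral {v g : Z → ℝ} (hv : Integrable v μ) (hg : Integrable g μ)
    {U : Set Z} (hU : IsOpen U) (η : Z)
    (h : ∀ φ : Z → ℝ, ContDiff ℝ ∞ φ → HasCompactSupport φ → tsupport φ ⊆ U →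
      ∀ s ∈ Ioc (0 : ℝ) 1, ∫ z, v z * fderiv ℝ φ (z - s • η) η ∂μ
        = -∫ z, g z * φ (z - s • η) ∂μ) :
    ∀ᵐ z ∂μ.restrict U, v (z + η) - v z = ∫ s in Ioc (0 : ℝ) 1, g (z + s • η) := by
  have hdiff : Integrable (fun z => v (z + η) - v z) μ := (hv.comp_add_right η).sub hv
  have hmean : Integrable (fun z => ∫ s in Ioc (0 : ℝ) 1, g (z + s • η)) μ :=
    (integrable_comp_shear hg (volume.restrict (Ioc (0 : ℝ) 1)) η).integral_prod_right
  have hzero := hU.ae_eq_zero_of_integral_contDiff_smul_eq_zero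
    ((hdiff.sub hmean).locallyIntegrable.locallyIntegrableOn U) fun φ hφ hφc hφU => ?_
  · rw [ae_restrict_iff' hU.measurableSet]
    filter_upwards [hzero] with z hz hzU using sub_eq_zero.1 (hz hzU)
  obtain ⟨C, hC⟩ := hφc.exists_bound_of_continuous hφ.continuous
  have hφv : ∀ {f : Z → ℝ}, Integrable f μ → Integrable (fun z => φ z * f z) μ := fun hf =>
    hf.bdd_mul hφ.continuous.aestronglyMeasurable (.of_forall hC)
  simp only [Pi.sub_apply, smul_eq_mul, mul_sub (φ _) (v _ - v _)]
  rw [integral_sub (hφv hdiff) (hφv hmean),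
    integral_mul_translate_sub hv hφ.continuous hφc η,
    integral_mul_sub_eq_integral_mul_average hv hg hφ hφc η (h φ hφ hφc hφU), sub_self]

theorem lintegral_sq_translate_sub_le {v g : Z → ℝ} (hv : Integrable v μ) (hg : Integrable g μ)
    {U : Set Z} (hU : IsOpen U) (η : Z)
    (h : ∀ φ : Z → ℝ, ContDiff ℝ ∞ φ → HasCompactSupport φ → tsupport φ ⊆ U →
      ∀ s ∈ Ioc (0 : ℝ) 1, ∫ z, v z * fderiv ℝ φ (z - s • η) η ∂μ
        = -∫ z, g z * φ (z - s • η) ∂μ) :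
    ∫⁻ z in U, ‖v (z + η) - v z‖ₑ ^ 2 ∂μ ≤ ∫⁻ z, ‖g z‖ₑ ^ 2 ∂μ := by
  set ν : Measure ℝ := volume.restrict (Ioc (0 : ℝ) 1)
  have hgs := integrable_comp_shear hg ν η
  calc ∫⁻ z in U, ‖v (z + η) - v z‖ₑ ^ 2 ∂μ
      ≤ ∫⁻ z in U, (∫⁻ s, ‖g (z + s • η)‖ₑ ^ 2 ∂ν) ∂μ := by
        refine lintegral_mono_ae ?_
        filter_upwards [translate_sub_eq_integral hv hg hU η h,
          ae_restrict_of_ae hgs.prod_left_ae] with z hz hzint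
        rw [hz]
        calc ‖∫ s, g (z + s • η) ∂ν‖ₑ ^ 2 ≤ (∫⁻ s, ‖g (z + s • η)‖ₑ ∂ν) ^ 2 := by
              gcongr; exact enorm_integral_le_lintegral_enorm _
          _ ≤ ν univ * ∫⁻ s, ‖g (z + s • η)‖ₑ ^ 2 ∂ν :=
              sq_lintegral_le_measure_univ_mul hzint.aestronglyMeasurable.enorm
          _ = ∫⁻ s, ‖g (z + s • η)‖ₑ ^ 2 ∂ν := by simp [ν]
    _ ≤ ∫⁻ z, (∫⁻ s, ‖g (z + s • η)‖ₑ ^ 2 ∂ν) ∂μ := setLIntegral_le_lintegral _ _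
    _ = ∫⁻ s, (∫⁻ z, ‖g (z + s • η)‖ₑ ^ 2 ∂μ) ∂ν :=
        lintegral_lintegral_swap (hgs.aestronglyMeasurable.enorm.pow_const 2).prod_swap
    _ = ∫⁻ s, (∫⁻ z, ‖g z‖ₑ ^ 2 ∂μ) ∂ν := by
        congr 1 with s
        exact lintegral_add_right_eq_self (fun z => ‖g z‖ₑ ^ 2) (s • η)
    _ = ∫⁻ z, ‖g z‖ₑ ^ 2 ∂μ := by simp [ν]

end TranslationEstimate

namespace HasL2SpatialGradient

variable {d : ℕ} {Q Q' : Set (ℝ × EuclideanSpace ℝ (Fin d))}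
  {u v : ℝ × EuclideanSpace ℝ (Fin d) → ℝ}
  {G : ℝ × EuclideanSpace ℝ (Fin d) → EuclideanSpace ℝ (Fin d)}

theorem mono (h : HasL2SpatialGradient Q u G) (hQm : MeasurableSet Q) (hQ : Q' ⊆ Q) :
    HasL2SpatialGradient Q' u G := by
  refine ⟨h.memLp.mono_measure (Measure.restrict_mono hQ le_rfl), fun φ hφ hφc hφQ v => ?_⟩
  have hφ0 : ∀ z ∉ Q', φ z = 0 := fun z hz =>
    image_eq_zero_of_notMem_tsupport fun hmem => hz (hφQ hmem)
  have hφ'0 : ∀ z ∉ Q', fderiv ℝ φ z = 0 := fun z hz =>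
    image_eq_zero_of_notMem_tsupport fun hmem => hz (hφQ (tsupport_fderiv_subset ℝ hmem))
  rw [← setIntegral_eq_of_subset_of_forall_sdiff_eq_zero hQm hQ
      fun z hz => by rw [hφ'0 z hz.2, zero_apply, mul_zero],
    h.integral_eq φ hφ hφc (hφQ.trans hQ) v,
    ← setIntegral_eq_of_subset_of_forall_sdiff_eq_zero hQm hQ
      fun z hz => by rw [hφ0 z hz.2, mul_zero]]

theorem congr (h : HasL2SpatialGradient Q u G) (huv : u =ᵐ[volume.restrict Q] v) :
    HasL2SpatialGradient Q v G where
  memLp := h.memLp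
  integral_eq φ hφ hφc hφQ e := by
    rw [← h.integral_eq φ hφ hφc hφQ e]
    exact integral_congr_ae (huv.mono fun z hz => by simp only [hz])

theorem const_mul (h : HasL2SpatialGradient Q u G) (c : ℝ) :
    HasL2SpatialGradient Q (fun z => c * u z) (fun z => c • G z) where
  memLp := h.memLp.const_smul c
  integral_eq φ hφ hφc hφQ e := by
    simp only [real_inner_smul_left, mul_assoc, integral_const_mul,
      h.integral_eq φ hφ hφc hφQ e, mul_neg]

theorem integral_indicator_mul_fderiv_sub (h : HasL2SpatialGradient Q u G)
    (hQm : MeasurableSet Q) {φ : ℝ × EuclideanSpace ℝ (Fin d) → ℝ} (hφ : ContDiff ℝ ∞ φ)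
    (hφc : HasCompactSupport φ) {w : ℝ × EuclideanSpace ℝ (Fin d)}
    (hφQ : ∀ z ∈ tsupport φ, z + w ∈ Q) (y : EuclideanSpace ℝ (Fin d)) :
    ∫ z, Q.indicator u z * fderiv ℝ φ (z - w) (0, y)
      = -∫ z, Q.indicator (fun z => inner ℝ (G z) y) z * φ (z - w) := by
  have hfderiv : ∀ z, fderiv ℝ (fun z => φ (z - w)) z = fderiv ℝ φ (z - w) := fun z => by
    simpa only [sub_eq_add_neg] using fderiv_comp_add_right (-w)
  have hsupp : tsupport (fun z => φ (z - w)) ⊆ Q := fun z hz => by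
    have hmem := tsupport_comp_subset_preimage φ (f := fun z => z - w) (by fun_prop) hz
    simpa only [sub_add_cancel] using hφQ _ hmem
  have weak := h.integral_eq (fun z => φ (z - w)) (by fun_prop)
    (hφc.comp_homeomorph (Homeomorph.subRight w)) hsupp y
  simp only [hfderiv] at weak
  simpa only [indicator_mul_left, ← integral_indicator hQm] using weak

theorem lintegral_sq_translate_sub_le (h : HasL2SpatialGradient Q v G) (hQm : MeasurableSet Q)
    (hQ : volume Q ≠ ⊤) (hv : IntegrableOn v Q) {U : Set (ℝ × EuclideanSpace ℝ (Fin d))}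
    (hU : IsOpen U) {y : EuclideanSpace ℝ (Fin d)}
    (hshift : ∀ z ∈ U, ∀ s ∈ Icc (0 : ℝ) 1, z + s • ((0 : ℝ), y) ∈ Q) :
    ∫⁻ z in U, ‖v (z + (0, y)) - v z‖ₑ ^ 2 ≤ ‖y‖ₑ ^ 2 * ∫⁻ z in Q, ‖G z‖ₑ ^ 2 := by
  have : IsFiniteMeasure (volume.restrict Q) := ⟨by simpa using hQ.lt_top⟩
  have : (volume : Measure (ℝ × EuclideanSpace ℝ (Fin d))).IsAddHaarMeasure :=
    inferInstanceAs ((volume : Measure ℝ).prod volume).IsAddHaarMeasure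
  have hGy : IntegrableOn (fun z => inner ℝ (G z) y) Q :=
    (h.memLp.integrable one_le_two).inner_const y
  have translate := _root_.lintegral_sq_translate_sub_le (hv.integrable_indicator hQm)
    (hGy.integrable_indicator hQm) hU (0, y) fun φ hφ hφc hφU s hs =>
      h.integral_indicator_mul_fderiv_sub hQm hφ hφc
        (fun z hz => hshift z (hφU hz) s (Ioc_subset_Icc_self hs)) y
  calc ∫⁻ z in U, ‖v (z + (0, y)) - v z‖ₑ ^ 2
      = ∫⁻ z in U, ‖Q.indicator v (z + (0, y)) - Q.indicator v z‖ₑ ^ 2 := by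
        refine setLIntegral_congr_fun hU.measurableSet fun z hz => ?_
        have h0 : z ∈ Q := by simpa using hshift z hz 0 (by simp)
        have h1 : z + (0, y) ∈ Q := by simpa using hshift z hz 1 (by simp)
        simp only [indicator_of_mem h0, indicator_of_mem h1]
    _ ≤ ∫⁻ z, ‖Q.indicator (fun z => inner ℝ (G z) y) z‖ₑ ^ 2 := translate
    _ = ∫⁻ z in Q, ‖inner ℝ (G z) y‖ₑ ^ 2 := by
        rw [← lintegral_indicator hQm]
        congr 1 with z
        by_cases hz : z ∈ Q <;> simp [hz]
    _ ≤ ∫⁻ z in Q, ‖y‖ₑ ^ 2 * ‖G z‖ₑ ^ 2 := by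
        refine lintegral_mono fun z => ?_
        rw [← mul_pow, mul_comm]
        gcongr
        rw [enorm_eq_nnnorm, enorm_eq_nnnorm, enorm_eq_nnnorm]
        exact_mod_cast nnnorm_inner_le_nnnorm (𝕜 := ℝ) (G z) y
    _ = ‖y‖ₑ ^ 2 * ∫⁻ z in Q, ‖G z‖ₑ ^ 2 := lintegral_const_mul' _ _ (by simp)

end HasL2SpatialGradient

section FaberKrahn

variable {E : Type*} [NormedAddCommGroup E] [MeasurableSpace E] [BorelSpace E]
  {F : Type*} [NormedAddCommGroup F]

theorem enorm_sq_le_enorm_sub_sq_add (a b : F) :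
    ‖a‖ₑ ^ 2 ≤ ‖b - a‖ₑ ^ 2 + 2 * (‖a‖ₑ * ‖b‖ₑ) := by
  have htri : ‖a‖ ≤ ‖b - a‖ + ‖b‖ := by
    simpa only [norm_sub_rev] using norm_le_norm_sub_add a b
  simp only [← ofReal_norm]
  rw [← ENNReal.ofReal_mul (by positivity), ← ENNReal.ofReal_ofNat,
    ← ENNReal.ofReal_mul (by positivity), ← ENNReal.ofReal_pow (by positivity),
    ← ENNReal.ofReal_pow (by positivity), ← ENNReal.ofReal_add (by positivity) (by positivity)]
  refine ENNReal.ofReal_le_ofReal ?_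
  rcases le_total ‖a‖ ‖b‖ with hab | hba
  · nlinarith [norm_nonneg a, sq_nonneg ‖b - a‖]
  · nlinarith [norm_nonneg b, norm_nonneg (b - a)]

theorem setLIntegral_ball_add_le {μ : Measure E} [μ.IsAddLeftInvariant] (f : E → ℝ≥0∞) {x : E}
    {r : ℝ} (hx : ‖x‖ < r) (h : ℝ) :
    ∫⁻ y in Metric.ball 0 h, f (x + y) ∂μ ≤ ∫⁻ y in Metric.ball 0 (r + h), f y ∂μ := by
  rw [← (measurePreserving_add_left μ x).setLIntegral_comp_preimage_emb
    (measurableEmbedding_addLeft x) f]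
  refine lintegral_mono_set fun y hy => ?_
  rw [mem_preimage, mem_ball_zero_iff]
  rw [mem_ball_zero_iff] at hy
  linarith [norm_add_le x y]

variable [SecondCountableTopology E]

theorem setLIntegral_mul_translate_le {μ : Measure E} [SFinite μ] [μ.IsAddLeftInvariant]
    {f : E → ℝ≥0∞} (hf : Measurable f) (r : ℝ) {h : ℝ} (hh : 0 ≤ h) :
    ∫⁻ y in Metric.ball 0 h, (∫⁻ x in Metric.ball 0 r, f x * f (x + y) ∂μ) ∂μ
      ≤ μ (Metric.ball 0 (r + h) ∩ Function.support f)
        * ∫⁻ x in Metric.ball 0 (r + h), f x ^ 2 ∂μ := by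
  calc ∫⁻ y in Metric.ball 0 h, (∫⁻ x in Metric.ball 0 r, f x * f (x + y) ∂μ) ∂μ
      = ∫⁻ x in Metric.ball 0 r, (∫⁻ y in Metric.ball 0 h, f x * f (x + y) ∂μ) ∂μ :=
        lintegral_lintegral_swap (Measurable.aemeasurable (by fun_prop))
    _ ≤ ∫⁻ x in Metric.ball 0 r, f x * (∫⁻ y in Metric.ball 0 (r + h), f y ∂μ) ∂μ := by
        refine setLIntegral_mono' measurableSet_ball fun x hx => ?_
        rw [lintegral_const_mul _ (by fun_prop)]
        exact mul_le_mul' le_rfl (setLIntegral_ball_add_le f (mem_ball_zero_iff.1 hx) h)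
    _ ≤ (∫⁻ x in Metric.ball 0 (r + h), f x ∂μ) ^ 2 := by
        rw [lintegral_mul_const _ hf, sq]
        gcongr
        linarith
    _ ≤ _ := sq_setLIntegral_le_measure_inter_support_mul hf _

theorem measure_ball_mul_setLIntegral_sq_le {μ : Measure E} [SFinite μ] [μ.IsAddLeftInvariant]
    {f : E → F} (hf : StronglyMeasurable f) (r : ℝ) {h : ℝ} (hh : 0 ≤ h) :
    μ (Metric.ball 0 h) * ∫⁻ x in Metric.ball 0 r, ‖f x‖ₑ ^ 2 ∂μ
      ≤ ∫⁻ y in Metric.ball 0 h, (∫⁻ x in Metric.ball 0 r, ‖f (x + y) - f x‖ₑ ^ 2 ∂μ) ∂μ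
        + 2 * (μ (Metric.ball 0 (r + h) ∩ Function.support f)
          * ∫⁻ x in Metric.ball 0 (r + h), ‖f x‖ₑ ^ 2 ∂μ) := by
  have hprod : Measurable fun q : E × E => ‖f q.2‖ₑ * ‖f (q.2 + q.1)‖ₑ :=
    (hf.enorm.comp measurable_snd).mul (hf.enorm.comp (measurable_snd.add measurable_fst))
  have hinner : Measurable fun y => ∫⁻ x in Metric.ball 0 r, ‖f x‖ₑ * ‖f (x + y)‖ₑ ∂μ :=
    hprod.lintegral_prod_right'
  have hsupp : Function.support (fun x => ‖f x‖ₑ) = Function.support f := by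
    ext x; simp
  calc μ (Metric.ball 0 h) * ∫⁻ x in Metric.ball 0 r, ‖f x‖ₑ ^ 2 ∂μ
      = ∫⁻ _ in Metric.ball 0 h, (∫⁻ x in Metric.ball 0 r, ‖f x‖ₑ ^ 2 ∂μ) ∂μ := by
        rw [setLIntegral_const, mul_comm]
    _ ≤ ∫⁻ y in Metric.ball 0 h, ((∫⁻ x in Metric.ball 0 r, ‖f (x + y) - f x‖ₑ ^ 2 ∂μ)
          + 2 * ∫⁻ x in Metric.ball 0 r, ‖f x‖ₑ * ‖f (x + y)‖ₑ ∂μ) ∂μ := by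
        refine lintegral_mono fun y => ?_
        have hm : Measurable fun x => ‖f x‖ₑ * ‖f (x + y)‖ₑ := hprod.comp measurable_prodMk_left
        rw [← lintegral_const_mul _ hm, ← lintegral_add_right _ (hm.const_mul 2)]
        exact lintegral_mono fun x => enorm_sq_le_enorm_sub_sq_add _ _
    _ = ∫⁻ y in Metric.ball 0 h, (∫⁻ x in Metric.ball 0 r, ‖f (x + y) - f x‖ₑ ^ 2 ∂μ) ∂μ
          + 2 * ∫⁻ y in Metric.ball 0 h,
              (∫⁻ x in Metric.ball 0 r, ‖f x‖ₑ * ‖f (x + y)‖ₑ ∂μ) ∂μ := by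
        rw [lintegral_add_right _ (hinner.const_mul 2), lintegral_const_mul _ hinner]
    _ ≤ _ := by
        gcongr
        rw [← hsupp]
        exact setLIntegral_mul_translate_le hf.enorm r hh

theorem lintegral_sq_le_of_translate {T : Type*} [MeasurableSpace T] {ν : Measure T} [SFinite ν]
    {μ : Measure E} [SFinite μ] [μ.IsAddLeftInvariant] {f : T × E → F}
    (hf : StronglyMeasurable f) {r h : ℝ} (hh : 0 ≤ h) {g m : ℝ≥0∞}
    (hg : ∀ y ∈ Metric.ball (0 : E) h,
      ∫⁻ t, (∫⁻ x in Metric.ball 0 r, ‖f (t, x + y) - f (t, x)‖ₑ ^ 2 ∂μ) ∂ν ≤ g)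
    (hm : ∀ᵐ t ∂ν, μ (Metric.ball 0 (r + h) ∩ Function.support fun x => f (t, x)) ≤ m)
    (hμ0 : μ (Metric.ball 0 h) ≠ 0) (hμ : μ (Metric.ball 0 h) ≠ ⊤)
    (h8 : 8 * m ≤ μ (Metric.ball 0 h)) :
    ∫⁻ t, (∫⁻ x in Metric.ball 0 r, ‖f (t, x)‖ₑ ^ 2 ∂μ) ∂ν
      ≤ g + 4⁻¹ * ∫⁻ t, (∫⁻ x in Metric.ball 0 (r + h), ‖f (t, x)‖ₑ ^ 2 ∂μ) ∂ν := by
  have hsq : ∀ ρ, Measurable fun t => ∫⁻ x in Metric.ball 0 ρ, ‖f (t, x)‖ₑ ^ 2 ∂μ := fun ρ =>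
    (hf.enorm.pow_const 2).lintegral_prod_right'
  have hdiff : Measurable fun q : (T × E) × E => ‖f (q.1.1, q.2 + q.1.2) - f (q.1.1, q.2)‖ₑ ^ 2 :=
    ((hf.comp_measurable (by fun_prop)).sub (hf.comp_measurable (by fun_prop))).enorm.pow_const 2
  have hdiff' : Measurable fun q : T × E =>
      ∫⁻ x in Metric.ball 0 r, ‖f (q.1, x + q.2) - f (q.1, x)‖ₑ ^ 2 ∂μ :=
    hdiff.lintegral_prod_right'
  rw [← ENNReal.mul_le_mul_iff_right hμ0 hμ]
  calc μ (Metric.ball 0 h) * ∫⁻ t, (∫⁻ x in Metric.ball 0 r, ‖f (t, x)‖ₑ ^ 2 ∂μ) ∂ν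
      = ∫⁻ t, μ (Metric.ball 0 h) * (∫⁻ x in Metric.ball 0 r, ‖f (t, x)‖ₑ ^ 2 ∂μ) ∂ν :=
        (lintegral_const_mul _ (hsq r)).symm
    _ ≤ ∫⁻ t, ((∫⁻ y in Metric.ball 0 h,
            (∫⁻ x in Metric.ball 0 r, ‖f (t, x + y) - f (t, x)‖ₑ ^ 2 ∂μ) ∂μ)
          + 2 * (m * ∫⁻ x in Metric.ball 0 (r + h), ‖f (t, x)‖ₑ ^ 2 ∂μ)) ∂ν := by
        refine lintegral_mono_ae (hm.mono fun t ht => ?_)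
        have hslice : StronglyMeasurable fun x => f (t, x) :=
          hf.comp_measurable measurable_prodMk_left
        refine (measure_ball_mul_setLIntegral_sq_le hslice r hh).trans ?_
        gcongr
    _ = ∫⁻ y in Metric.ball 0 h,
            (∫⁻ t, (∫⁻ x in Metric.ball 0 r, ‖f (t, x + y) - f (t, x)‖ₑ ^ 2 ∂μ) ∂ν) ∂μ
          + 2 * m * ∫⁻ t, (∫⁻ x in Metric.ball 0 (r + h), ‖f (t, x)‖ₑ ^ 2 ∂μ) ∂ν := by
        simp only [← mul_assoc]
        rw [lintegral_add_right _ ((hsq _).const_mul _), lintegral_const_mul _ (hsq _),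
          lintegral_lintegral_swap hdiff'.aemeasurable]
    _ ≤ μ (Metric.ball 0 h) * g + μ (Metric.ball 0 h) * (4⁻¹
          * ∫⁻ t, (∫⁻ x in Metric.ball 0 (r + h), ‖f (t, x)‖ₑ ^ 2 ∂μ) ∂ν) := by
        have h2 : 2 * m ≤ μ (Metric.ball 0 h) * 4⁻¹ := by
          rw [← div_eq_mul_inv, ENNReal.le_div_iff_mul_le (by norm_num) (by norm_num)]
          exact le_of_eq_of_le (by ring) h8
        rw [← mul_assoc (μ _) 4⁻¹]
        refine add_le_add ?_ (by gcongr)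
        refine (setLIntegral_mono' measurableSet_ball hg).trans_eq ?_
        rw [setLIntegral_const, mul_comm]
    _ = _ := (mul_add _ _ _).symm

end FaberKrahn

section RadialIteration

variable {A : ℝ → ℝ≥0∞} {c : ℝ≥0∞} {h r R : ℝ}

theorem le_add_inv_four_pow_mul_of_step
    (hstep : ∀ ρ, ρ + h ≤ R → A ρ ≤ c + 4⁻¹ * A (ρ + h)) (hA : Monotone A) (hh : 0 ≤ h) (m : ℕ)
    (hr : r + m * h ≤ R) : A r ≤ 2 * c + 4⁻¹ ^ m * A R := by
  induction m generalizing r with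
  | zero =>
    have hrR : r ≤ R := by simpa using hr
    simpa using (hA hrR).trans le_add_self
  | succ m ih =>
    push_cast at hr
    have hmh : 0 ≤ m * h := by positivity
    have hc : 4⁻¹ * (2 * c) ≤ c := by
      calc 4⁻¹ * (2 * c) ≤ 4⁻¹ * (4 * c) := by gcongr; norm_num
        _ = c := ENNReal.inv_mul_cancel_left (by norm_num) (by norm_num)
    calc A r ≤ c + 4⁻¹ * A (r + h) := hstep r (by linarith)
      _ ≤ c + 4⁻¹ * (2 * c + 4⁻¹ ^ m * A R) := by gcongr; exact ih (by linarith)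
      _ = c + 4⁻¹ * (2 * c) + 4⁻¹ ^ (m + 1) * A R := by ring
      _ ≤ c + c + 4⁻¹ ^ (m + 1) * A R := by gcongr
      _ = 2 * c + 4⁻¹ ^ (m + 1) * A R := by rw [two_mul]

theorem exists_inv_four_pow_le (hh : 0 < h) (hhR : h ≤ R) :
    ∃ m : ℕ, m * h ≤ R ∧ (4⁻¹ : ℝ≥0∞) ^ m ≤ ENNReal.ofReal (4 * (h / R) ^ 2) := by
  have hR : 0 < R := hh.trans_le hhR
  set m : ℕ := ⌊R / h⌋₊
  refine ⟨m, (le_div_iff₀ hh).1 (Nat.floor_le (by positivity)), ?_⟩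
  have hm : R / h ≤ 2 * 2 ^ m := by
    have hm1 : (1 : ℝ) ≤ 2 ^ m := one_le_pow₀ one_le_two
    have hm2 : (m : ℝ) ≤ 2 ^ m := by exact_mod_cast (Nat.lt_two_pow_self).le
    linarith [Nat.lt_floor_add_one (R / h)]
  have hsq : (R / h) ^ 2 ≤ 4 * 4 ^ m := by
    calc (R / h) ^ 2 ≤ (2 * 2 ^ m) ^ 2 := by gcongr
      _ = 4 * 4 ^ m := by rw [mul_pow, ← pow_mul, mul_comm m, pow_mul]; norm_num
  have hpow : (4⁻¹ : ℝ≥0∞) ^ m = ENNReal.ofReal ((4 ^ m)⁻¹) := by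
    rw [← ENNReal.inv_pow, ENNReal.ofReal_inv_of_pos (by positivity),
      ENNReal.ofReal_pow (by norm_num), ENNReal.ofReal_ofNat]
  rw [hpow]
  refine ENNReal.ofReal_le_ofReal ?_
  rw [← inv_div, inv_pow, ← div_eq_mul_inv, inv_le_comm₀ (by positivity) (by positivity), inv_div,
    div_le_iff₀ (by norm_num)]
  linarith

theorem le_add_sq_div_mul_of_step
    (hstep : ∀ ρ, ρ + h ≤ R → A ρ ≤ c + 4⁻¹ * A (ρ + h)) (hA : Monotone A) (hh : 0 < h)
    (hrR : r < R) : A r ≤ 2 * c + ENNReal.ofReal (4 * (h / (R - r)) ^ 2) * A R := by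
  have hgap : 0 < R - r := sub_pos.2 hrR
  rcases le_or_gt h (R - r) with hle | hlt
  · obtain ⟨m, hmR, hm⟩ := exists_inv_four_pow_le hh hle
    refine (le_add_inv_four_pow_mul_of_step hstep hA hh.le m (by linarith)).trans ?_
    gcongr
  · have hone : 1 ≤ h / (R - r) := (one_le_div hgap).2 hlt.le
    refine (hA hrR.le).trans (le_add_left (le_mul_of_one_le_left' ?_))
    rw [ENNReal.one_le_ofReal]
    nlinarith

end RadialIteration

section LocalFaberKrahn

variable {E : Type*} [NormedAddCommGroup E] [NormedSpace ℝ E] [FiniteDimensional ℝ E]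
  [Nontrivial E] [MeasurableSpace E] [BorelSpace E] {μ : Measure E} [μ.IsAddHaarMeasure]

variable (μ) in
theorem exists_measure_ball_eq {s : ℝ} (hs : 0 < s) :
    ∃ h : ℝ, 0 < h ∧ μ (Metric.ball 0 h) = ENNReal.ofReal s ∧
      h ^ 2 = (s / μ.real (Metric.ball 0 1)) ^ (2 / (Module.finrank ℝ E : ℝ)) := by
  set n : ℕ := Module.finrank ℝ E
  set κ : ℝ := μ.real (Metric.ball 0 1)
  have hκ : 0 < κ := ENNReal.toReal_pos (Metric.measure_ball_pos μ _ one_pos).ne'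
    measure_ball_lt_top.ne
  have hn : (n : ℝ) ≠ 0 := by exact_mod_cast (Module.finrank_pos (R := ℝ) (M := E)).ne'
  refine ⟨(s / κ) ^ (1 / (n : ℝ)), by positivity, ?_, ?_⟩
  · rw [Measure.addHaar_ball_of_pos _ _ (by positivity), ← Real.rpow_natCast,
      ← Real.rpow_mul (by positivity), one_div_mul_cancel hn, Real.rpow_one,
      ← ofReal_measureReal measure_ball_lt_top.ne, ← ENNReal.ofReal_mul (by positivity),
      div_mul_cancel₀ _ hκ.ne']
  · rw [← Real.rpow_natCast, ← Real.rpow_mul (by positivity)]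
    congr 1
    push_cast
    ring

theorem local_faberKrahn {T : Type*} [MeasurableSpace T] {ν : Measure T} [SFinite ν]
    {F : Type*} [NormedAddCommGroup F] {f : T × E → F} (hf : StronglyMeasurable f)
    {r R s : ℝ} {g : ℝ≥0∞}
    (hg : ∀ (ρ : ℝ) (y : E), ρ + ‖y‖ ≤ R →
      ∫⁻ t, (∫⁻ x in Metric.ball 0 ρ, ‖f (t, x + y) - f (t, x)‖ₑ ^ 2 ∂μ) ∂ν ≤ ‖y‖ₑ ^ 2 * g)
    (hs : 0 < s)
    (hsupp : ∀ᵐ t ∂ν,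
      μ (Metric.ball 0 R ∩ Function.support fun x => f (t, x)) ≤ ENNReal.ofReal s)
    (hrR : r < R) :
    ∫⁻ t, (∫⁻ x in Metric.ball 0 r, ‖f (t, x)‖ₑ ^ 2 ∂μ) ∂ν
      ≤ ENNReal.ofReal
          (4 * (8 * s / μ.real (Metric.ball 0 1)) ^ (2 / (Module.finrank ℝ E : ℝ)))
        * (g + ENNReal.ofReal (1 / (R - r) ^ 2) *
          ∫⁻ t, (∫⁻ x in Metric.ball 0 R, ‖f (t, x)‖ₑ ^ 2 ∂μ) ∂ν) := by
  obtain ⟨h, hh, hball, hsq⟩ := exists_measure_ball_eq μ (mul_pos (by norm_num : (0 : ℝ) < 8) hs)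
  set A : ℝ → ℝ≥0∞ := fun ρ => ∫⁻ t, (∫⁻ x in Metric.ball 0 ρ, ‖f (t, x)‖ₑ ^ 2 ∂μ) ∂ν
  have hA : Monotone A := fun ρ₁ ρ₂ hρ =>
    lintegral_mono fun t => lintegral_mono_set (Metric.ball_subset_ball hρ)
  have hstep : ∀ ρ, ρ + h ≤ R → A ρ ≤ ENNReal.ofReal (h ^ 2) * g + 4⁻¹ * A (ρ + h) := by
    intro ρ hρ
    refine lintegral_sq_le_of_translate hf hh.le (m := ENNReal.ofReal s) (fun y hy => ?_)
      (hsupp.mono fun t ht => le_trans (by gcongr) ht)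
      (Metric.measure_ball_pos μ 0 hh).ne' measure_ball_lt_top.ne ?_
    · rw [mem_ball_zero_iff] at hy
      refine (hg ρ y (by linarith)).trans ?_
      rw [← ofReal_sq_eq_enorm_sq]
      gcongr
    · rw [hball, ENNReal.ofReal_mul (by norm_num), ENNReal.ofReal_ofNat]
  refine (le_add_sq_div_mul_of_step hstep hA hh hrR).trans ?_
  rw [← hsq, mul_add, ← mul_assoc, ← mul_assoc, ← ENNReal.ofReal_mul (by positivity), div_pow,
    mul_one_div, mul_div_assoc]
  gcongr
  rw [← ENNReal.ofReal_ofNat, ← ENNReal.ofReal_mul (by norm_num)]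
  exact ENNReal.ofReal_le_ofReal (by nlinarith [sq_nonneg h])

end LocalFaberKrahn

section EnergyBound

variable {d : ℕ}

local notation "𝔼" => EuclideanSpace ℝ (Fin d)

theorem isOpen_parabolicCylinder (r : ℝ) : IsOpen (parabolicCylinder d r) :=
  isOpen_Ioo.prod Metric.isOpen_ball

theorem measurableSet_parabolicCylinder (r : ℝ) : MeasurableSet (parabolicCylinder d r) :=
  (isOpen_parabolicCylinder r).measurableSet

theorem volume_parabolicCylinder_lt_top (r : ℝ) : volume (parabolicCylinder d r) < ⊤ := by
  rw [parabolicCylinder, Measure.volume_eq_prod, Measure.prod_prod]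
  exact ENNReal.mul_lt_top measure_Ioo_lt_top measure_ball_lt_top

theorem parabolicCylinder_subset {r R : ℝ} (hr : 0 ≤ r) (hrR : r ≤ R) :
    parabolicCylinder d r ⊆ parabolicCylinder d R :=
  prod_mono (Ioo_subset_Ioo_left (by gcongr)) (Metric.ball_subset_ball hrR)

theorem setLIntegral_parabolicCylinder {r : ℝ} {f : ℝ × 𝔼 → ℝ≥0∞}
    (hf : AEMeasurable f (volume.restrict (parabolicCylinder d r))) :
    ∫⁻ z in parabolicCylinder d r, f z
      = ∫⁻ t in Ioo (-r ^ 2) 0, ∫⁻ x in Metric.ball (0 : 𝔼) r, f (t, x) := by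
  rw [parabolicCylinder, Measure.volume_eq_prod] at *
  exact setLIntegral_prod _ hf

/-- The parabolic energy of `v` on `Q_ρ` is at most `E`: the square integrals of `v` over almost all
time slices, and that of a weak spatial gradient over `Q_ρ`. The function `v` is required to be
Borel, so that its slices are. -/
structure HasEnergyBound (v : ℝ × 𝔼 → ℝ) (ρ E : ℝ) : Prop where
  measurable : Measurable v
  slice : ∀ᵐ t ∂volume.restrict (Ioo (-ρ ^ 2) 0),
    ∫⁻ x in Metric.ball (0 : 𝔼) ρ, ENNReal.ofReal (v (t, x) ^ 2) ≤ ENNReal.ofReal E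
  exists_gradient : ∃ G, HasL2SpatialGradient (parabolicCylinder d ρ) v G ∧
    ∫⁻ z in parabolicCylinder d ρ, ENNReal.ofReal (‖G z‖ ^ 2) ≤ ENNReal.ofReal E

variable {v : ℝ × EuclideanSpace ℝ (Fin d) → ℝ} {r R E E' : ℝ}

theorem HasEnergyBound.mono (h : HasEnergyBound v R E) (hr : 0 ≤ r) (hrR : r ≤ R) (hE : E ≤ E') :
    HasEnergyBound v r E' := by
  have hsub : parabolicCylinder d r ⊆ parabolicCylinder d R := parabolicCylinder_subset hr hrR
  have hEE' : ENNReal.ofReal E ≤ ENNReal.ofReal E' := ENNReal.ofReal_le_ofReal hE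
  obtain ⟨G, hG, hGE⟩ := h.exists_gradient
  refine ⟨h.measurable, ?_, G, hG.mono (measurableSet_parabolicCylinder R) hsub,
    (lintegral_mono_set hsub).trans (hGE.trans hEE')⟩
  filter_upwards [ae_restrict_of_ae_restrict_of_subset
    (Ioo_subset_Ioo_left (show -R ^ 2 ≤ -r ^ 2 by gcongr)) h.slice] with t ht
  exact (lintegral_mono_set (Metric.ball_subset_ball hrR)).trans (ht.trans hEE')

theorem HasEnergyBound.lintegral_sq_le (h : HasEnergyBound v R E) :
    ∫⁻ z in parabolicCylinder d R, ENNReal.ofReal (v z ^ 2) ≤ ENNReal.ofReal (R ^ 2 * E) := by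
  have hv := h.measurable
  rw [setLIntegral_parabolicCylinder (by fun_prop)]
  refine (lintegral_mono_ae h.slice).trans ?_
  rw [setLIntegral_const, Real.volume_Ioo, mul_comm, sub_neg_eq_add, zero_add,
    ENNReal.ofReal_mul (sq_nonneg R)]

theorem HasEnergyBound.integrableOn (h : HasEnergyBound v R E) :
    IntegrableOn v (parabolicCylinder d R) := by
  have : IsFiniteMeasure (volume.restrict (parabolicCylinder d R)) :=
    ⟨by simpa using volume_parabolicCylinder_lt_top R⟩
  refine MemLp.integrable one_le_two ⟨h.measurable.aestronglyMeasurable, ?_⟩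
  refine (ENNReal.pow_lt_top_iff.1 ?_).resolve_right two_ne_zero
  rw [eLpNorm_two_sq_eq_lintegral]
  exact h.lintegral_sq_le.trans_lt ENNReal.ofReal_lt_top

theorem HasEnergyBound.lintegral_sq_translate_sub_le (h : HasEnergyBound v R E) {ρ : ℝ} {y : 𝔼}
    (hy : ρ + ‖y‖ ≤ R) :
    ∫⁻ t in Ioo (-R ^ 2) 0, (∫⁻ x in Metric.ball (0 : 𝔼) ρ, ‖v (t, x + y) - v (t, x)‖ₑ ^ 2)
      ≤ ‖y‖ₑ ^ 2 * ENNReal.ofReal E := by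
  have hv := h.measurable
  obtain ⟨G, hG, hGE⟩ := h.exists_gradient
  simp only [ofReal_sq_eq_enorm_sq] at hGE
  have translate := hG.lintegral_sq_translate_sub_le (measurableSet_parabolicCylinder R)
    (volume_parabolicCylinder_lt_top R).ne h.integrableOn (y := y)
    (U := Ioo (-R ^ 2) 0 ×ˢ Metric.ball 0 ρ) (isOpen_Ioo.prod Metric.isOpen_ball) ?_
  · rw [Measure.volume_eq_prod, setLIntegral_prod _ (by fun_prop)] at translate
    simp only [Prod.mk_add_mk, add_zero] at translate
    exact translate.trans (mul_le_mul' le_rfl hGE)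
  · rintro ⟨t, x⟩ ⟨ht, hx⟩ s hs
    rw [mem_ball_zero_iff] at hx
    refine ⟨by simpa using ht, mem_ball_zero_iff.2 ?_⟩
    calc ‖x + s • y‖ ≤ ‖x‖ + ‖s • y‖ := norm_add_le _ _
      _ ≤ ‖x‖ + ‖y‖ := by
        rw [norm_smul, Real.norm_of_nonneg hs.1]
        gcongr
        exact mul_le_of_le_one_left (norm_nonneg y) hs.2
      _ < R := by linarith

theorem HasEnergyBound.measure_superlevel_le (h : HasEnergyBound v R E) {l : ℝ} (hl : 0 < l) :
    ∀ᵐ t ∂volume.restrict (Ioo (-R ^ 2) 0),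
      volume (Metric.ball (0 : 𝔼) R ∩ Function.support fun x => max (v (t, x) - l) 0)
        ≤ ENNReal.ofReal (E / l ^ 2) := by
  have hv := h.measurable
  have hl2 : 0 < l ^ 2 := by positivity
  filter_upwards [h.slice] with t ht
  have chebyshev := meas_ge_le_lintegral_div (μ := volume.restrict (Metric.ball (0 : 𝔼) R))
    (f := fun x => ENNReal.ofReal (v (t, x) ^ 2)) (by fun_prop)
    (ENNReal.ofReal_pos.2 hl2).ne' ENNReal.ofReal_ne_top
  rw [ENNReal.ofReal_div_of_pos hl2]
  refine le_trans ?_ (chebyshev.trans (by gcongr))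
  rw [Measure.restrict_apply (measurableSet_le measurable_const (by fun_prop)), inter_comm]
  refine measure_mono (inter_subset_inter_left _ fun x hx => ENNReal.ofReal_le_ofReal ?_)
  have hlx : l < v (t, x) := by
    by_contra! hle
    exact hx (max_eq_right (sub_nonpos.2 hle))
  gcongr

theorem abs_max_sub_zero_le {a l : ℝ} (hl : 0 ≤ l) : |max (a - l) 0| ≤ |a| := by
  rw [abs_of_nonneg (le_max_right _ _)]
  exact max_le (by linarith [le_abs_self a]) (abs_nonneg a)

theorem faberKrahn_superlevel_const_le {κ r R E l : ℝ} (hκ : 0 ≤ κ) (hr : 0 ≤ r) (hrR : r < R)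
    (hE : 0 < E) (hl : 0 ≤ l) (n : ℝ) :
    4 * (8 * (E / l ^ 2) / κ) ^ (2 / n) * (E + 1 / (R - r) ^ 2 * (R ^ 2 * E))
      ≤ 8 * (8 / κ) ^ (2 / n) * (l ^ (-(4 / n)) * E ^ (1 + 2 / n) * (R / (R - r)) ^ 2) := by
  have hpow : (8 * (E / l ^ 2) / κ) ^ (2 / n)
      = (8 / κ) ^ (2 / n) * (l ^ (-(4 / n)) * E ^ (2 / n)) := by
    rw [mul_div_right_comm, Real.mul_rpow (by positivity) (by positivity),
      Real.div_rpow hE.le (sq_nonneg l), Real.rpow_neg hl, show 4 / n = 2 * (2 / n) by ring,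
      Real.rpow_mul hl, Real.rpow_two, div_eq_inv_mul (E ^ (2 / n))]
  have hone : 1 ≤ (R / (R - r)) ^ 2 :=
    one_le_pow₀ ((one_le_div (sub_pos.2 hrR)).2 (by linarith))
  rw [hpow, Real.rpow_add hE, Real.rpow_one]
  calc 4 * ((8 / κ) ^ (2 / n) * (l ^ (-(4 / n)) * E ^ (2 / n)))
        * (E + 1 / (R - r) ^ 2 * (R ^ 2 * E))
      = 4 * (8 / κ) ^ (2 / n) * (l ^ (-(4 / n)) * (E * E ^ (2 / n)))
        * (1 + (R / (R - r)) ^ 2) := by rw [div_pow]; ring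
    _ ≤ 4 * (8 / κ) ^ (2 / n) * (l ^ (-(4 / n)) * (E * E ^ (2 / n)))
        * (2 * (R / (R - r)) ^ 2) := by gcongr; linarith
    _ = _ := by ring

theorem exists_lintegral_sq_truncation_le (hd : 1 ≤ d) :
    ∃ C : ℝ, 0 < C ∧ ∀ (v : ℝ × 𝔼 → ℝ) (r R E l : ℝ), HasEnergyBound v R E →
      0 ≤ r → r < R → 0 < E → 0 < l →
      ∫⁻ z in parabolicCylinder d r, ENNReal.ofReal (max (v z - l) 0 ^ 2)
        ≤ ENNReal.ofReal
          (C * (l ^ (-(4 / (d : ℝ))) * E ^ (1 + 2 / (d : ℝ)) * (R / (R - r)) ^ 2)) := by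
  have : NeZero d := ⟨by omega⟩
  set κ : ℝ := volume.real (Metric.ball (0 : 𝔼) 1)
  have hκ : 0 < κ :=
    ENNReal.toReal_pos (Metric.measure_ball_pos volume _ one_pos).ne' measure_ball_lt_top.ne
  refine ⟨8 * (8 / κ) ^ (2 / (d : ℝ)), by positivity, fun v r R E l h hr hrR hE hl => ?_⟩
  have hv := h.measurable
  have faberKrahn := local_faberKrahn (μ := (volume : Measure 𝔼))
    (ν := volume.restrict (Ioo (-R ^ 2) 0)) (f := fun z => max (v z - l) 0) (s := E / l ^ 2)
    (Measurable.stronglyMeasurable (by fun_prop)) (fun ρ y hy => le_trans (lintegral_mono fun t =>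
      lintegral_mono fun x => ?_) (h.lintegral_sq_translate_sub_le hy)) (by positivity)
    (h.measure_superlevel_le hl) hrR
  swap
  · gcongr
    rw [enorm_le_iff_norm_le]
    simpa using abs_max_sub_max_le_abs (v (t, x + y) - l) (v (t, x) - l) 0
  have hsq : ∫⁻ t in Ioo (-R ^ 2) 0, (∫⁻ x in Metric.ball 0 R, ‖max (v (t, x) - l) 0‖ₑ ^ 2)
      ≤ ENNReal.ofReal (R ^ 2 * E) := by
    refine le_trans ?_ h.lintegral_sq_le
    rw [setLIntegral_parabolicCylinder (by fun_prop)]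
    refine lintegral_mono fun t => lintegral_mono fun x => ?_
    rw [← ofReal_sq_eq_enorm]
    exact ENNReal.ofReal_le_ofReal (sq_le_sq.2 (abs_max_sub_zero_le hl.le))
  simp only [finrank_euclideanSpace_fin, ← ofReal_sq_eq_enorm] at faberKrahn hsq
  rw [setLIntegral_parabolicCylinder (by fun_prop)]
  refine (lintegral_mono_set (Ioo_subset_Ioo_left (show -R ^ 2 ≤ -r ^ 2 by gcongr))).trans
    (faberKrahn.trans ((mul_le_mul' le_rfl (add_le_add le_rfl (mul_le_mul' le_rfl hsq))).trans ?_))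
  rw [← ENNReal.ofReal_mul (by positivity), ← ENNReal.ofReal_add hE.le (by positivity),
    ← ENNReal.ofReal_mul (by positivity)]
  exact ENNReal.ofReal_le_ofReal (faberKrahn_superlevel_const_le hκ.le hr hrR hE hl.le d)

end EnergyBound

section HigherIntegrability

theorem max_max_sub_sub (a k : ℝ) {l : ℝ} (hl : 0 ≤ l) :
    max (max (a - k) 0 - l) 0 = max (a - (k + l)) 0 := by
  rw [← max_sub_sub_right, max_assoc, zero_sub, max_eq_right (neg_nonpos.2 hl), sub_sub]

theorem rpow_le_two_rpow_mul {x c q : ℝ} (hx : 0 ≤ x) (hc : 0 ≤ c) (hq : 0 ≤ q) :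
    x ^ q ≤ 2 ^ q * (max (x - c) 0 ^ q + c ^ q) := by
  set m := max (x - c) 0
  have hm : 0 ≤ m := le_max_right _ _
  have hx2 : x ≤ 2 * max m c := by
    linarith [le_max_left (x - c) 0, le_max_left m c, le_max_right m c]
  calc x ^ q ≤ (2 * max m c) ^ q := by gcongr
    _ = 2 ^ q * max m c ^ q := Real.mul_rpow zero_le_two (hm.trans (le_max_left m c))
    _ ≤ 2 ^ q * (m ^ q + c ^ q) := by
      gcongr
      rcases max_choice m c with h | h <;> rw [h]
      · exact le_add_of_nonneg_right (by positivity)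
      · exact le_add_of_nonneg_left (by positivity)

theorem lintegral_rpow_le_truncation {α : Type*} [MeasurableSpace α] {μ : Measure α} {f : α → ℝ}
    (hf : ∀ a, 0 ≤ f a) {c q : ℝ} (hc : 0 ≤ c) (hq : 0 ≤ q) :
    ∫⁻ a, ENNReal.ofReal (f a ^ q) ∂μ ≤ ENNReal.ofReal (2 ^ q) *
      (∫⁻ a, ENNReal.ofReal (max (f a - c) 0 ^ q) ∂μ + ENNReal.ofReal (c ^ q) * μ univ) := by
  rw [← lintegral_const, ← lintegral_add_right _ measurable_const,
    ← lintegral_const_mul' _ _ ENNReal.ofReal_ne_top]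
  refine lintegral_mono fun a => ?_
  rw [← ENNReal.ofReal_add (by positivity) (by positivity), ← ENNReal.ofReal_mul (by positivity)]
  exact ENNReal.ofReal_le_ofReal (rpow_le_two_rpow_mul (hf a) hc hq)

theorem rpow_le_mul_rpow_mul_sq {a b q : ℝ} (hb : 0 < b) (hba : b ≤ a) (hab : a ≤ 2 * b) :
    a ^ q ≤ 4 * 2 ^ |q - 2| * b ^ (q - 2) * max (a - b / 2) 0 ^ 2 := by
  have ha : 0 < a := hb.trans_le hba
  have hratio : (a / b) ^ (q - 2) ≤ 2 ^ |q - 2| :=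
    calc (a / b) ^ (q - 2) ≤ (a / b) ^ |q - 2| :=
          Real.rpow_le_rpow_of_exponent_le ((one_le_div hb).2 hba) (le_abs_self _)
      _ ≤ 2 ^ |q - 2| := by
          gcongr
          exact (div_le_iff₀ hb).2 hab
  have hhalf : a ≤ 2 * max (a - b / 2) 0 := by linarith [le_max_left (a - b / 2) 0]
  calc a ^ q = b ^ (q - 2) * (a / b) ^ (q - 2) * a ^ 2 := by
        rw [← Real.mul_rpow hb.le (by positivity), mul_div_cancel₀ _ hb.ne', ← Real.rpow_two,
          ← Real.rpow_add ha, sub_add_cancel]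
    _ ≤ b ^ (q - 2) * 2 ^ |q - 2| * (2 * max (a - b / 2) 0) ^ 2 := by gcongr
    _ = _ := by ring

theorem rpow_le_tsum_dyadic {q c a : ℝ} (hq : 0 < q) (hc : 0 < c) :
    ENNReal.ofReal (max (a - c) 0 ^ q) ≤ ∑' j : ℕ,
      ENNReal.ofReal (4 * 2 ^ |q - 2| * (c * 2 ^ j) ^ (q - 2)) *
        ENNReal.ofReal (max (a - c * 2 ^ j / 2) 0 ^ 2) := by
  rcases le_or_gt a c with hac | hac
  · simp [max_eq_right (sub_nonpos.2 hac), Real.zero_rpow hq.ne']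
  have ha : 0 < a := hc.trans hac
  obtain ⟨j, hj, hj'⟩ := exists_nat_pow_near ((one_le_div hc).2 hac.le) (one_lt_two (α := ℝ))
  rw [le_div_iff₀ hc] at hj
  rw [div_lt_iff₀ hc, pow_succ] at hj'
  refine le_trans ?_ (ENNReal.le_tsum j)
  rw [← ENNReal.ofReal_mul (by positivity)]
  refine ENNReal.ofReal_le_ofReal (le_trans ?_ (rpow_le_mul_rpow_mul_sq (a := a) (by positivity)
    (by linarith) (by linarith)))
  gcongr
  exact max_le (by linarith) ha.le

variable {d : ℕ}

local notation "𝔼" => EuclideanSpace ℝ (Fin d)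

theorem exists_lintegral_rpow_truncation_le (hd : 1 ≤ d) {q : ℝ} (hq : 0 < q)
    (hq2 : q < 2 + 4 / (d : ℝ)) :
    ∃ C : ℝ, 0 < C ∧ ∀ (v : ℝ × 𝔼 → ℝ) (r R E c : ℝ), HasEnergyBound v R E →
      0 ≤ r → r < R → 0 < E → 0 < c →
      ∫⁻ z in parabolicCylinder d r, ENNReal.ofReal (max (v z - c) 0 ^ q)
        ≤ ENNReal.ofReal
          (C * (c ^ (q - 2 - 4 / (d : ℝ)) * E ^ (1 + 2 / (d : ℝ)) * (R / (R - r)) ^ 2)) := by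
  obtain ⟨C, hC, truncation⟩ := exists_lintegral_sq_truncation_le hd
  set α : ℝ := 4 / (d : ℝ)
  set θ : ℝ := 2 ^ (q - 2 - α)
  have hθ : 0 < θ := by positivity
  have hθ1 : θ < 1 := Real.rpow_lt_one_of_one_lt_of_neg one_lt_two (by linarith)
  refine ⟨4 * 2 ^ |q - 2| * C * 2 ^ α * (1 - θ)⁻¹, by positivity, ?_⟩
  intro v r R E c h hr hrR hE hc
  have hv := h.measurable
  set Y : ℝ := E ^ (1 + 2 / (d : ℝ)) * (R / (R - r)) ^ 2
  set B : ℝ := 4 * 2 ^ |q - 2| * C * 2 ^ α * c ^ (q - 2 - α) * Y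
  have hscale (j : ℕ) : (c * 2 ^ j) ^ (q - 2) * (c * 2 ^ j / 2) ^ (-α)
      = 2 ^ α * c ^ (q - 2 - α) * θ ^ j := by
    have hcj : 0 < c * 2 ^ j := by positivity
    rw [Real.div_rpow hcj.le zero_le_two, Real.rpow_neg zero_le_two, div_inv_eq_mul, ← mul_assoc,
      ← Real.rpow_add hcj, ← sub_eq_add_neg, Real.mul_rpow hc.le (by positivity),
      Real.rpow_pow_comm zero_le_two]
    ring
  calc ∫⁻ z in parabolicCylinder d r, ENNReal.ofReal (max (v z - c) 0 ^ q)
      ≤ ∫⁻ z in parabolicCylinder d r, ∑' j : ℕ,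
          ENNReal.ofReal (4 * 2 ^ |q - 2| * (c * 2 ^ j) ^ (q - 2)) *
            ENNReal.ofReal (max (v z - c * 2 ^ j / 2) 0 ^ 2) :=
        lintegral_mono fun z => rpow_le_tsum_dyadic hq hc
    _ = ∑' j : ℕ, ENNReal.ofReal (4 * 2 ^ |q - 2| * (c * 2 ^ j) ^ (q - 2)) *
          ∫⁻ z in parabolicCylinder d r, ENNReal.ofReal (max (v z - c * 2 ^ j / 2) 0 ^ 2) := by
        rw [lintegral_tsum fun j => by fun_prop]
        simp only [lintegral_const_mul' _ _ ENNReal.ofReal_ne_top]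
    _ ≤ ∑' j : ℕ, ENNReal.ofReal (B * θ ^ j) := by
        gcongr with j
        refine (mul_le_mul' le_rfl
          (truncation v r R E (c * 2 ^ j / 2) h hr hrR hE (by positivity))).trans_eq ?_
        rw [← ENNReal.ofReal_mul (by positivity)]
        congr 1
        linear_combination 4 * 2 ^ |q - 2| * C * Y * hscale j
    _ = ENNReal.ofReal (B * (1 - θ)⁻¹) := by
        rw [← ENNReal.ofReal_tsum_of_nonneg (fun j => by positivity)
          ((summable_geometric_of_lt_one hθ.le hθ1).mul_left B), tsum_mul_left,
          tsum_geometric_of_lt_one hθ.le hθ1]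
    _ = _ := by congr 1; ring

theorem exists_lintegral_rpow_le (hd : 1 ≤ d) {q : ℝ} (hq : 0 < q) (hq2 : q < 2 + 4 / (d : ℝ)) :
    ∃ C : ℝ, 0 < C ∧ ∀ (v : ℝ × 𝔼 → ℝ) (r R E : ℝ), HasEnergyBound v R E → (∀ z, 0 ≤ v z) →
      0 ≤ r → r < R → R ≤ 1 → 0 < E →
      ∫⁻ z in parabolicCylinder d r, ENNReal.ofReal (v z ^ q)
        ≤ ENNReal.ofReal (C * (E ^ (q / 2) / (R - r) ^ 2)) := by
  obtain ⟨C, hC, truncation⟩ := exists_lintegral_rpow_truncation_le hd hq hq2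
  set V : ℝ := volume.real (parabolicCylinder d 1)
  refine ⟨2 ^ q * (C + V), by positivity, fun v r R E h hv0 hr hrR hR hE => ?_⟩
  have hgap : 0 < R - r := sub_pos.2 hrR
  have hvol : volume (parabolicCylinder d r) ≤ ENNReal.ofReal V := by
    rw [ofReal_measureReal (volume_parabolicCylinder_lt_top 1).ne]
    exact measure_mono (parabolicCylinder_subset hr (hrR.le.trans hR))
  -- The truncation estimate is applied at the level `√E`, where it scales like `E ^ (q / 2)`.
  have hexponent : √E ^ (q - 2 - 4 / (d : ℝ)) * E ^ (1 + 2 / (d : ℝ)) = E ^ (q / 2) := by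
    rw [Real.sqrt_eq_rpow, ← Real.rpow_mul hE.le, ← Real.rpow_add hE]
    ring_nf
  have hsqrt : √E ^ q = E ^ (q / 2) := by
    rw [Real.sqrt_eq_rpow, ← Real.rpow_mul hE.le, one_div_mul_eq_div]
  have key := truncation v r R E (√E) h hr hrR hE (Real.sqrt_pos.2 hE)
  rw [hexponent] at key
  calc ∫⁻ z in parabolicCylinder d r, ENNReal.ofReal (v z ^ q)
      ≤ ENNReal.ofReal (2 ^ q) *
          ((∫⁻ z in parabolicCylinder d r, ENNReal.ofReal (max (v z - √E) 0 ^ q))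
            + ENNReal.ofReal (√E ^ q) * volume (parabolicCylinder d r)) := by
        simpa using lintegral_rpow_le_truncation (μ := volume.restrict (parabolicCylinder d r))
          hv0 (Real.sqrt_nonneg E) hq.le
    _ ≤ ENNReal.ofReal (2 ^ q) * (ENNReal.ofReal (C * (E ^ (q / 2) * (R / (R - r)) ^ 2))
          + ENNReal.ofReal (√E ^ q) * ENNReal.ofReal V) := by gcongr
    _ ≤ ENNReal.ofReal (2 ^ q * (C + V) * (E ^ (q / 2) / (R - r) ^ 2)) := by
        rw [← ENNReal.ofReal_mul (by positivity),
          ← ENNReal.ofReal_add (by positivity) (by positivity),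
          ← ENNReal.ofReal_mul (by positivity), hsqrt]
        refine ENNReal.ofReal_le_ofReal ?_
        have hR2 : R ^ 2 ≤ 1 := pow_le_one₀ (by linarith) hR
        have hgap2 : (R - r) ^ 2 ≤ 1 := pow_le_one₀ hgap.le (by linarith)
        calc 2 ^ q * (C * (E ^ (q / 2) * (R / (R - r)) ^ 2) + E ^ (q / 2) * V)
            = 2 ^ q * ((C * R ^ 2 + V * (R - r) ^ 2) * (E ^ (q / 2) / (R - r) ^ 2)) := by
              field_simp
          _ ≤ 2 ^ q * ((C * 1 + V * 1) * (E ^ (q / 2) / (R - r) ^ 2)) := by gcongr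
          _ = _ := by ring

end HigherIntegrability

section Caccioppoli

variable {d : ℕ} {γ₁ γ₂ γ₃ p T₁ T₂ : ℝ} {Ω : Set (EuclideanSpace ℝ (Fin d))}
  {u v : ℝ × EuclideanSpace ℝ (Fin d) → ℝ}

local notation "𝔼" => EuclideanSpace ℝ (Fin d)

theorem DeGiorgiSubclass.mono (h : DeGiorgiSubclass T₁ T₂ Ω γ₁ γ₂ γ₃ p u)
    (hΩm : MeasurableSet Ω) {T₁' T₂' : ℝ} {Ω' : Set 𝔼} (hT₁ : T₁ ≤ T₁') (hT₂ : T₂' ≤ T₂)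
    (hΩ : Ω' ⊆ Ω) : DeGiorgiSubclass T₁' T₂' Ω' γ₁ γ₂ γ₃ p u := by
  have hT : Ioo T₁' T₂' ⊆ Ioo T₁ T₂ := Ioo_subset_Ioo hT₁ hT₂
  have hQ : Ioo T₁' T₂' ×ˢ Ω' ⊆ Ioo T₁ T₂ ×ˢ Ω := prod_mono hT hΩ
  have hQm : MeasurableSet (Ioo T₁ T₂ ×ˢ Ω) := measurableSet_Ioo.prod hΩm
  obtain ⟨M, hM⟩ := h.memLinftyL2.bounded
  obtain ⟨G, hG⟩ := h.exists_gradient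
  refine ⟨⟨h.memLinftyL2.aestronglyMeasurable.mono_set hQ, M, ?_⟩, ⟨G, hG.mono hQm hQ⟩,
    fun k => ?_⟩
  · filter_upwards [ae_restrict_of_ae_restrict_of_subset hT hM] with t ht
    exact (eLpNorm_mono_measure _ (Measure.restrict_mono hΩ le_rfl)).trans ht
  · obtain ⟨Gk, hGk, henergy⟩ := h.energy k
    refine ⟨Gk, hGk.mono hQm hQ, fun r R x₀ hr hrR hx₀ hball => ?_⟩
    filter_upwards [ae_restrict_of_ae_restrict_of_subset hT
      (henergy r R x₀ hr hrR (hΩ hx₀) (hball.trans hΩ))] with s hs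
    exact ae_restrict_of_ae_restrict_of_subset hT hs

theorem ae_ae_eq_of_ae_eq_restrict_prod (huv : u =ᵐ[volume.restrict (Ioo T₁ T₂ ×ˢ Ω)] v) :
    ∀ᵐ t ∂volume.restrict (Ioo T₁ T₂), ∀ᵐ x ∂volume.restrict Ω, u (t, x) = v (t, x) := by
  rw [Measure.volume_eq_prod, ← Measure.prod_restrict] at huv
  exact Measure.ae_ae_of_ae_prod huv

theorem EnergyInequality.congr {k : ℝ} {G : ℝ × 𝔼 → 𝔼} {x₀ : 𝔼} {r R s t : ℝ}
    (h : EnergyInequality γ₁ γ₂ γ₃ p u k G x₀ r R s t) (hrR : r ≤ R)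
    (hs : ∀ᵐ x ∂volume.restrict (Metric.ball x₀ R), u (s, x) = v (s, x))
    (ht : ∀ᵐ x ∂volume.restrict (Metric.ball x₀ R), u (t, x) = v (t, x))
    (hst : ∀ᵐ τ ∂volume.restrict (Ioo s t),
      ∀ᵐ x ∂volume.restrict (Metric.ball x₀ R), u (τ, x) = v (τ, x)) :
    EnergyInequality γ₁ γ₂ γ₃ p v k G x₀ r R s t := by
  have slice_eq (F : ℝ → ℝ≥0∞) {τ ρ : ℝ} (hρ : ρ ≤ R)
      (hτ : ∀ᵐ x ∂volume.restrict (Metric.ball x₀ R), u (τ, x) = v (τ, x)) :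
      ∫⁻ x in Metric.ball x₀ ρ, F (u (τ, x)) = ∫⁻ x in Metric.ball x₀ ρ, F (v (τ, x)) := by
    refine lintegral_congr_ae ?_
    filter_upwards [ae_restrict_of_ae_restrict_of_subset (Metric.ball_subset_ball hρ) hτ]
      with x hx
    rw [hx]
  have time_eq (F : ℝ → ℝ≥0∞) :
      ∫⁻ τ in Ioo s t, ∫⁻ x in Metric.ball x₀ R, F (u (τ, x))
        = ∫⁻ τ in Ioo s t, ∫⁻ x in Metric.ball x₀ R, F (v (τ, x)) :=
    lintegral_congr_ae (hst.mono fun τ hτ => slice_eq F le_rfl hτ)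
  unfold EnergyInequality at h ⊢
  rwa [slice_eq (fun a => ENNReal.ofReal (max (a - k) 0 ^ 2)) hrR ht,
    slice_eq (fun a => ENNReal.ofReal (max (a - k) 0 ^ 2)) le_rfl hs,
    time_eq fun a => ENNReal.ofReal (max (a - k) 0 ^ 2),
    time_eq fun a => ENNReal.ofReal (max (a - k) 0 ^ p)] at h

theorem DeGiorgiSubclass.congr (h : DeGiorgiSubclass T₁ T₂ Ω γ₁ γ₂ γ₃ p u)
    (huv : u =ᵐ[volume.restrict (Ioo T₁ T₂ ×ˢ Ω)] v) :
    DeGiorgiSubclass T₁ T₂ Ω γ₁ γ₂ γ₃ p v := by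
  have hslice := ae_ae_eq_of_ae_eq_restrict_prod huv
  obtain ⟨M, hM⟩ := h.memLinftyL2.bounded
  obtain ⟨G, hG⟩ := h.exists_gradient
  refine ⟨⟨h.memLinftyL2.aestronglyMeasurable.congr huv, M, ?_⟩, ⟨G, hG.congr huv⟩, fun k => ?_⟩
  · filter_upwards [hM, hslice] with t ht huvt
    rwa [← eLpNorm_congr_ae huvt]
  · obtain ⟨Gk, hGk, henergy⟩ := h.energy k
    refine ⟨Gk, hGk.congr (huv.fun_comp fun a => max (a - k) 0), fun r R x₀ hr hrR hx₀ hball => ?_⟩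
    have hball_eq : ∀ᵐ τ ∂volume.restrict (Ioo T₁ T₂),
        ∀ᵐ x ∂volume.restrict (Metric.ball x₀ R), u (τ, x) = v (τ, x) :=
      hslice.mono fun τ hτ => ae_restrict_of_ae_restrict_of_subset hball hτ
    filter_upwards [henergy r R x₀ hr hrR hx₀ hball, hball_eq, ae_restrict_mem measurableSet_Ioo]
      with s hs huvs hsT
    filter_upwards [hs, hball_eq, ae_restrict_mem measurableSet_Ioo] with t ht huvt htT hst
    exact (ht hst).congr hrR.le huvs huvt
      (ae_restrict_of_ae_restrict_of_subset (Ioo_subset_Ioo hsT.1.le htT.2.le) hball_eq)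

theorem EnergyInequality.le {k : ℝ} {G : ℝ × 𝔼 → 𝔼} {x₀ : 𝔼} {r R s t a A B : ℝ}
    (h : EnergyInequality γ₁ γ₂ γ₃ p u k G x₀ r R s t)
    (hγ₂ : 0 ≤ γ₂) (hγ₃ : 0 ≤ γ₃) (hp : 0 ≤ p) (ha : 0 ≤ a) (hA : 0 ≤ A) (hB : 0 ≤ B)
    (hs : ∫⁻ x in Metric.ball x₀ R, ENNReal.ofReal (max (u (s, x) - k) 0 ^ 2) ≤ ENNReal.ofReal a)
    (hsq : ∫⁻ τ in Ioo s t, ∫⁻ x in Metric.ball x₀ R, ENNReal.ofReal (max (u (τ, x) - k) 0 ^ 2)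
      ≤ ENNReal.ofReal A)
    (hpow : ∫⁻ τ in Ioo s t, ∫⁻ x in Metric.ball x₀ R, ENNReal.ofReal (max (u (τ, x) - k) 0 ^ p)
      ≤ ENNReal.ofReal B) :
    (∫⁻ x in Metric.ball x₀ r, ENNReal.ofReal (max (u (t, x) - k) 0 ^ 2)) + ENNReal.ofReal γ₁ *
      (∫⁻ τ in Ioo s t, ∫⁻ x in Metric.ball x₀ r, ENNReal.ofReal (‖G (τ, x)‖ ^ 2))
    ≤ ENNReal.ofReal (a + γ₂ / (R - r) ^ 2 * A + γ₃ * B ^ (1 / p)) := by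
  rw [ENNReal.ofReal_add (by positivity) (by positivity),
    ENNReal.ofReal_add (by positivity) (by positivity), ENNReal.ofReal_mul (by positivity),
    ENNReal.ofReal_mul (by positivity), ← ENNReal.ofReal_rpow_of_nonneg hB (by positivity)]
  exact h.trans (add_le_add (add_le_add hs (mul_le_mul' le_rfl hsq))
    (mul_le_mul' le_rfl (ENNReal.rpow_le_rpow hpow (by positivity))))

theorem parabolicCylinder_one : parabolicCylinder d 1 = Ioo (-1) 0 ×ˢ Metric.ball 0 1 := by
  simp [parabolicCylinder]

theorem DeGiorgiSubclass.exists_energy_le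
    (h : DeGiorgiSubclass (-1) 0 (Metric.ball 0 1) γ₁ γ₂ γ₃ p u) (hu : Measurable u)
    (hγ₂ : 0 ≤ γ₂) (hγ₃ : 0 ≤ γ₃) (hp : 0 ≤ p) {k r R A B : ℝ}
    (hr : 0 < r) (hrR : r < R) (hR : R ≤ 1) (hA : 0 ≤ A) (hB : 0 ≤ B)
    (hsq : ∫⁻ z in parabolicCylinder d R, ENNReal.ofReal (max (u z - k) 0 ^ 2) ≤ ENNReal.ofReal A)
    (hpow : ∫⁻ z in parabolicCylinder d R, ENNReal.ofReal (max (u z - k) 0 ^ p)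
      ≤ ENNReal.ofReal B) :
    ∃ G, HasL2SpatialGradient (parabolicCylinder d r) (fun z => max (u z - k) 0) G ∧
      ∀ᵐ t ∂volume.restrict (Ioo (-r ^ 2) 0),
        (∫⁻ x in Metric.ball (0 : 𝔼) r, ENNReal.ofReal (max (u (t, x) - k) 0 ^ 2))
          + ENNReal.ofReal γ₁ * (∫⁻ τ in Ioo (-r ^ 2) t, ∫⁻ x in Metric.ball (0 : 𝔼) r,
            ENNReal.ofReal (‖G (τ, x)‖ ^ 2))
        ≤ ENNReal.ofReal ((1 + γ₂ + γ₃) * (A / (R - r) ^ 2 + B ^ (1 / p))) := by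
  have hgap : 0 < R - r := sub_pos.2 hrR
  have hgap_sq : (R - r) ^ 2 ≤ -r ^ 2 - -R ^ 2 := by nlinarith
  have hrR2 : -R ^ 2 < -r ^ 2 := by nlinarith
  have hR1 : -1 ≤ -R ^ 2 := neg_le_neg (pow_le_one₀ (hr.trans hrR).le hR)
  rw [setLIntegral_parabolicCylinder (by fun_prop)] at hsq hpow
  obtain ⟨G, hG, henergy⟩ := h.energy k
  rw [← parabolicCylinder_one] at hG
  refine ⟨G, hG.mono (measurableSet_parabolicCylinder 1)
    (parabolicCylinder_subset hr.le (hrR.le.trans hR)), ?_⟩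
  obtain ⟨s, hs, hsenergy, hsA⟩ := exists_mem_Ioo_le_lintegral_div hrR2
    (f := fun t => ∫⁻ x in Metric.ball (0 : 𝔼) R, ENNReal.ofReal (max (u (t, x) - k) 0 ^ 2))
    (Measurable.aemeasurable (Measurable.lintegral_prod_right (by fun_prop)))
    (ae_restrict_of_ae_restrict_of_subset (Ioo_subset_Ioo hR1 (neg_nonpos.2 (sq_nonneg r)))
      (henergy r R 0 hr hrR (by simp) (Metric.ball_subset_ball hR)))
  have hslice := hsA.trans (ENNReal.div_le_div
    ((lintegral_mono_set (Ioo_subset_Ioo_right (neg_nonpos.2 (sq_nonneg r)))).trans hsq)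
    (ENNReal.ofReal_le_ofReal hgap_sq))
  rw [← ENNReal.ofReal_div_of_pos (by positivity)] at hslice
  filter_upwards [ae_restrict_of_ae_restrict_of_subset
    (Ioo_subset_Ioo_left (hR1.trans hrR2.le)) hsenergy, ae_restrict_mem measurableSet_Ioo]
    with t ht htr
  have hst : Ioo s t ⊆ Ioo (-R ^ 2) 0 := Ioo_subset_Ioo hs.1.le htr.2.le
  have henergy_le := (ht (hs.2.trans htr.1)).le hγ₂ hγ₃ hp (by positivity) hA hB hslice
    ((lintegral_mono_set hst).trans hsq) ((lintegral_mono_set hst).trans hpow)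
  refine (add_le_add le_rfl (mul_le_mul' le_rfl
    (lintegral_mono_set (Ioo_subset_Ioo_left hs.2.le)))).trans
    (henergy_le.trans (ENNReal.ofReal_le_ofReal ?_))
  have hA' : 0 ≤ A / (R - r) ^ 2 := by positivity
  have hB' : 0 ≤ B ^ (1 / p) := by positivity
  rw [div_mul_eq_mul_div, mul_div_assoc]
  nlinarith [mul_nonneg hγ₂ hB', mul_nonneg hγ₃ hA']

theorem DeGiorgiSubclass.hasEnergyBound
    (h : DeGiorgiSubclass (-1) 0 (Metric.ball 0 1) γ₁ γ₂ γ₃ p u) (hu : Measurable u)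
    (hγ₁ : 0 < γ₁) (hγ₂ : 0 ≤ γ₂) (hγ₃ : 0 ≤ γ₃) (hp : 0 ≤ p) {k r R A B : ℝ}
    (hr : 0 < r) (hrR : r < R) (hR : R ≤ 1) (hA : 0 ≤ A) (hB : 0 ≤ B)
    (hsq : ∫⁻ z in parabolicCylinder d R, ENNReal.ofReal (max (u z - k) 0 ^ 2) ≤ ENNReal.ofReal A)
    (hpow : ∫⁻ z in parabolicCylinder d R, ENNReal.ofReal (max (u z - k) 0 ^ p)
      ≤ ENNReal.ofReal B) :
    HasEnergyBound (fun z => max (u z - k) 0) r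
      ((1 + 1 / γ₁) * (1 + γ₂ + γ₃) * (A / (R - r) ^ 2 + B ^ (1 / p))) := by
  obtain ⟨G, hG, henergy⟩ := h.exists_energy_le hu hγ₂ hγ₃ hp hr hrR hR hA hB hsq hpow
  rw [mul_assoc]
  set M := (1 + γ₂ + γ₃) * (A / (R - r) ^ 2 + B ^ (1 / p))
  have hM : 0 ≤ M := by positivity
  have hGm : AEMeasurable (fun z => ENNReal.ofReal (‖G z‖ ^ 2))
      (volume.restrict (parabolicCylinder d r)) :=
    (hG.memLp.aestronglyMeasurable.norm.aemeasurable.pow_const 2).ennreal_ofReal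
  refine ⟨by fun_prop, ?_, G, hG, ?_⟩
  · filter_upwards [henergy] with t ht
    refine le_self_add.trans (ht.trans (ENNReal.ofReal_le_ofReal ?_))
    exact le_mul_of_one_le_left hM (le_add_of_nonneg_right (by positivity))
  · rw [setLIntegral_parabolicCylinder hGm]
    refine (setLIntegral_Ioo_le_of_ae (M := ENNReal.ofReal (M / γ₁)) ?_).trans
      (ENNReal.ofReal_le_ofReal ?_)
    · filter_upwards [henergy] with t ht
      rw [ENNReal.ofReal_div_of_pos hγ₁, ENNReal.le_div_iff_mul_le
        (.inl (ENNReal.ofReal_pos.2 hγ₁).ne') (.inl ENNReal.ofReal_ne_top), mul_comm]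
      exact le_add_self.trans ht
    · rw [div_eq_mul_one_div, mul_comm]
      gcongr
      exact le_add_of_nonneg_left zero_le_one

theorem DeGiorgiSubclass.exists_hasEnergyBound
    (h : DeGiorgiSubclass (-1) 0 (Metric.ball 0 1) γ₁ γ₂ γ₃ p u) (hu : Measurable u)
    {k : ℝ} (hk : 0 ≤ k) : ∃ E, HasEnergyBound (fun z => max (u z - k) 0) 1 E := by
  obtain ⟨M, hM⟩ := h.memLinftyL2.bounded
  obtain ⟨G, hG, -⟩ := h.energy k
  rw [← parabolicCylinder_one] at hG
  set e : ℝ≥0∞ := eLpNorm (fun z => ‖G z‖) 2 (volume.restrict (parabolicCylinder d 1)) ^ 2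
  have he : e ≠ ⊤ := ENNReal.pow_ne_top hG.memLp.norm.2.ne
  refine ⟨max (max M 0 ^ 2) e.toReal, by fun_prop, ?_, G, hG, ?_⟩
  · rw [one_pow]
    filter_upwards [hM] with t ht
    calc ∫⁻ x in Metric.ball 0 1, ENNReal.ofReal (max (u (t, x) - k) 0 ^ 2)
        ≤ ∫⁻ x in Metric.ball 0 1, ENNReal.ofReal (u (t, x) ^ 2) :=
          lintegral_mono fun x =>
            ENNReal.ofReal_le_ofReal (sq_le_sq.2 (abs_max_sub_zero_le hk))
      _ = eLpNorm (fun x => u (t, x)) 2 (volume.restrict (Metric.ball 0 1)) ^ 2 :=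
          (eLpNorm_two_sq_eq_lintegral _).symm
      _ ≤ ENNReal.ofReal (max M 0) ^ 2 := by
          gcongr
          exact ht.trans (ENNReal.ofReal_le_ofReal (le_max_left M 0))
      _ ≤ ENNReal.ofReal (max (max M 0 ^ 2) e.toReal) := by
          rw [← ENNReal.ofReal_pow (le_max_right M 0)]
          exact ENNReal.ofReal_le_ofReal (le_max_left _ _)
  · rw [← eLpNorm_two_sq_eq_lintegral]
    exact (ENNReal.ofReal_toReal he).symm.trans_le (ENNReal.ofReal_le_ofReal (le_max_right _ _))

end Caccioppoli

section Absorption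

variable {d : ℕ} {γ₁ γ₂ γ₃ p : ℝ}

local notation "𝔼" => EuclideanSpace ℝ (Fin d)

theorem DeGiorgiSubclass.exists_hasEnergyBound_add_sqrt (hd : 1 ≤ d)
    (hγ₁ : 0 < γ₁) (hγ₂ : 0 ≤ γ₂) (hγ₃ : 0 ≤ γ₃) (hp : 1 ≤ p) (hp2 : p < 2 + 4 / (d : ℝ)) :
    ∃ C : ℝ, 0 < C ∧ ∀ (u : ℝ × 𝔼 → ℝ) (k r R E A : ℝ),
      DeGiorgiSubclass (-1) 0 (Metric.ball 0 1) γ₁ γ₂ γ₃ p u → Measurable u →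
      HasEnergyBound (fun z => max (u z - k) 0) R E →
      0 < r → r < R → R ≤ 1 → 0 < E → 0 ≤ A →
      ∫⁻ z in parabolicCylinder d R, ENNReal.ofReal (max (u z - k) 0 ^ 2) ≤ ENNReal.ofReal A →
      HasEnergyBound (fun z => max (u z - k) 0) r (C * ((A + √E) / (R - r) ^ 2)) := by
  have hp0 : 0 < p := by linarith
  obtain ⟨C, hC, higher⟩ := exists_lintegral_rpow_le hd hp0 hp2
  refine ⟨(1 + 1 / γ₁) * (1 + γ₂ + γ₃) * (4 * (1 + C ^ (1 / p))), by positivity,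
    fun u k r R E A hu hum hE hr hrR hR hE0 hA hsq => ?_⟩
  set g : ℝ := (R - r) / 2 with hg
  have hg0 : 0 < g := by linarith
  have hg1 : g ≤ 1 := by linarith
  have hgr : r + g - r = g := by ring
  have hgR : R - (r + g) = g := by rw [hg]; ring
  have hpow := higher _ (r + g) R E hE (fun z => le_max_right _ _) (by linarith) (by linarith) hR
    hE0
  rw [hgR] at hpow
  refine (hu.hasEnergyBound hum hγ₁ hγ₂ hγ₃ hp0.le (R := r + g) hr (by linarith) (by linarith) hA
    (by positivity) ((lintegral_mono_set (parabolicCylinder_subset (by linarith)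
      (by linarith))).trans hsq) hpow).mono hr.le le_rfl ?_
  have hroot : (C * (E ^ (p / 2) / g ^ 2)) ^ (1 / p) ≤ C ^ (1 / p) * (√E / g ^ 2) := by
    have hinv : 1 ≤ (g ^ 2)⁻¹ := (one_le_inv₀ (by positivity)).2 (pow_le_one₀ hg0.le hg1)
    have hsqrt : (E ^ (p / 2)) ^ (1 / p) = √E := by
      rw [Real.sqrt_eq_rpow, ← Real.rpow_mul hE0.le]
      congr 1
      field_simp
    rw [div_eq_mul_inv (E ^ _), div_eq_mul_inv (√E), Real.mul_rpow hC.le (by positivity),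
      Real.mul_rpow (by positivity) (by positivity), hsqrt]
    gcongr
    exact Real.rpow_le_self_of_one_le hinv ((div_le_one hp0).2 hp)
  rw [hgr, show R - r = 2 * g by rw [hg]; ring, mul_assoc _ (4 * _)]
  gcongr
  calc A / g ^ 2 + (C * (E ^ (p / 2) / g ^ 2)) ^ (1 / p)
      ≤ A / g ^ 2 + C ^ (1 / p) * (√E / g ^ 2) := by gcongr
    _ ≤ A / g ^ 2 + C ^ (1 / p) * (√E / g ^ 2)
          + (√E / g ^ 2 + C ^ (1 / p) * (A / g ^ 2)) := le_add_of_nonneg_right (by positivity)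
    _ = 4 * (1 + C ^ (1 / p)) * ((A + √E) / (2 * g) ^ 2) := by
        field_simp
        ring

theorem of_forall_of_absorb_step {P : ℕ → ℝ → Prop} {F M E₀ : ℝ} (hF : 0 ≤ F) (hM : 1 ≤ M)
    (step : ∀ (i : ℕ) (E : ℝ), 0 < E → P (i + 1) E → P i (E / (2 * M) + F * M ^ i))
    (mono : ∀ E E' : ℝ, E ≤ E' → P 0 E → P 0 E') (hE₀ : 0 < E₀) (h : ∀ m, P m E₀) :
    P 0 (1 + 2 * F) := by
  have iterate (m : ℕ) : ∀ E : ℝ, 0 < E → P m E →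
      P 0 (E / (2 * M) ^ m + 2 * F * (1 - (1 / 2) ^ m)) := by
    induction m with
    | zero => intro E _ hE; simpa using hE
    | succ m ih =>
      intro E hE0 hE
      convert ih _ (by positivity) (step m E hE0 hE) using 1
      simp only [mul_pow, one_div, inv_pow, pow_succ]
      field_simp
      ring
  obtain ⟨m, hm⟩ := pow_unbounded_of_one_lt E₀ (show 1 < 2 * M by linarith)
  refine mono _ _ (add_le_add ?_ ?_) (iterate m E₀ hE₀ (h m))
  · exact (div_le_one (by positivity)).2 hm.le
  · exact mul_le_of_le_one_right (by positivity) (sub_le_self 1 (by positivity))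

theorem mul_four_pow_mul_add_le {D A S : ℝ} (hD : 0 ≤ D) (hA : 0 ≤ A) (i : ℕ) :
    D * 4 ^ i * (A + S) ≤ S ^ 2 / 32 + (D * A + 8 * D ^ 2) * 16 ^ i := by
  have h16 : (16 : ℝ) ^ i = (4 ^ i) ^ 2 := by rw [← pow_mul, mul_comm, pow_mul]; norm_num
  have h4 : (4 : ℝ) ^ i ≤ 16 ^ i := pow_le_pow_left₀ (by norm_num) (by norm_num) i
  have hDA : D * A * 4 ^ i ≤ D * A * 16 ^ i := by gcongr
  rw [h16] at hDA ⊢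
  linarith [sq_nonneg (S - 16 * (D * 4 ^ i))]

/-- The `Lᵖ` term of the energy inequality is of order `√E` in the energy `E` on a larger cylinder,
hence is absorbed by iterating over increasing radii. -/
theorem DeGiorgiSubclass.exists_hasEnergyBound_of_lintegral_sq_le (hd : 1 ≤ d)
    (hγ₁ : 0 < γ₁) (hγ₂ : 0 ≤ γ₂) (hγ₃ : 0 ≤ γ₃) (hp : 1 ≤ p) (hp2 : p < 2 + 4 / (d : ℝ))
    {r A : ℝ} (hr : 0 < r) (hr1 : r < 1) (hA : 0 ≤ A) :
    ∃ K : ℝ, 0 < K ∧ ∀ (u : ℝ × 𝔼 → ℝ) (k : ℝ),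
      DeGiorgiSubclass (-1) 0 (Metric.ball 0 1) γ₁ γ₂ γ₃ p u → Measurable u → 0 ≤ k →
      ∫⁻ z in parabolicCylinder d 1, ENNReal.ofReal (max (u z - k) 0 ^ 2) ≤ ENNReal.ofReal A →
      HasEnergyBound (fun z => max (u z - k) 0) r K := by
  obtain ⟨C, hC, energy_step⟩ :=
    DeGiorgiSubclass.exists_hasEnergyBound_add_sqrt hd hγ₁ hγ₂ hγ₃ hp hp2
  have hr1' : 0 < 1 - r := sub_pos.2 hr1
  set D : ℝ := C * (4 / (1 - r) ^ 2) with hD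
  have hD0 : 0 < D := by positivity
  refine ⟨1 + 2 * (D * A + 8 * D ^ 2), by positivity, fun u k hu hum hk hsq => ?_⟩
  set ρ : ℕ → ℝ := fun i => 1 - (1 - r) / 2 ^ i with hρ
  have hrρ (i : ℕ) : r ≤ ρ i := by
    have := div_le_self hr1'.le (one_le_pow₀ (n := i) (one_le_two (α := ℝ)))
    simp only [hρ]
    linarith
  have hρ1 (i : ℕ) : ρ i ≤ 1 := sub_le_self 1 (by positivity)
  have hgap (i : ℕ) : ρ (i + 1) - ρ i = (1 - r) / (2 * 2 ^ i) := by
    simp only [hρ, pow_succ]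
    field_simp
    ring
  obtain ⟨E, hE⟩ := hu.exists_hasEnergyBound hum hk
  have key := of_forall_of_absorb_step (F := D * A + 8 * D ^ 2) (M := 16) (E₀ := max E 1)
    (P := fun i E => HasEnergyBound (fun z => max (u z - k) 0) (ρ i) E)
    (by positivity) (by norm_num) ?_ (fun _ _ hle h => h.mono (hr.le.trans (hrρ 0)) le_rfl hle)
    (by positivity) fun i => hE.mono (hr.le.trans (hrρ i)) (hρ1 i) (le_max_left E 1)
  · exact key.mono hr.le (hrρ 0) le_rfl
  · intro i E hE0 hE
    have hgap0 : 0 < ρ (i + 1) - ρ i := by rw [hgap]; positivity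
    refine (energy_step u k (ρ i) (ρ (i + 1)) E A hu hum hE (hr.trans_le (hrρ i))
      (sub_pos.1 hgap0) (hρ1 _) hE0 hA ((lintegral_mono_set (parabolicCylinder_subset
        (hr.le.trans (hrρ _)) (hρ1 _))).trans hsq)).mono (hr.le.trans (hrρ i)) le_rfl ?_
    calc C * ((A + √E) / (ρ (i + 1) - ρ i) ^ 2)
        = D * (2 ^ i) ^ 2 * (A + √E) := by
          rw [hgap, hD]
          field_simp
          ring
      _ = D * 4 ^ i * (A + √E) := by rw [← pow_mul, mul_comm i, pow_mul]; norm_num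
      _ ≤ √E ^ 2 / 32 + (D * A + 8 * D ^ 2) * 16 ^ i := mul_four_pow_mul_add_le hD0.le hA i
      _ = E / (2 * 16) + (D * A + 8 * D ^ 2) * 16 ^ i := by rw [Real.sq_sqrt hE0.le]; norm_num

end Absorption

section Smallness

variable {d : ℕ} {γ₁ γ₂ γ₃ p : ℝ}

local notation "𝔼" => EuclideanSpace ℝ (Fin d)

theorem rpow_truncation_le {a l M q : ℝ} (ha : 0 ≤ a) (hl : 0 < l) (hM : 0 ≤ M) (hq : 0 < q) :
    max (a - l) 0 ^ q ≤ 2 ^ q * (max (a - M) 0 ^ q + M ^ q / l ^ 2 * a ^ 2) := by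
  rcases le_total a l with hal | hla
  · rw [max_eq_right (sub_nonpos.2 hal), Real.zero_rpow hq.ne']
    positivity
  · rw [max_eq_left (sub_nonneg.2 hla)]
    have hone : 1 ≤ a ^ 2 / l ^ 2 := (one_le_div (by positivity)).2 (by gcongr)
    calc (a - l) ^ q ≤ a ^ q := Real.rpow_le_rpow (sub_nonneg.2 hla) (by linarith) hq.le
      _ ≤ 2 ^ q * (max (a - M) 0 ^ q + M ^ q) := rpow_le_two_rpow_mul ha hM hq.le
      _ ≤ 2 ^ q * (max (a - M) 0 ^ q + M ^ q * (a ^ 2 / l ^ 2)) := by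
        gcongr
        exact le_mul_of_one_le_right (by positivity) hone
      _ = _ := by ring

theorem lintegral_rpow_truncation_le {α : Type*} [MeasurableSpace α] {μ : Measure α} {v : α → ℝ}
    (hv : Measurable v) (hv0 : ∀ z, 0 ≤ v z) {l M q : ℝ} (hl : 0 < l) (hM : 0 ≤ M) (hq : 0 < q) :
    ∫⁻ z, ENNReal.ofReal (max (v z - l) 0 ^ q) ∂μ
      ≤ ENNReal.ofReal (2 ^ q) * ((∫⁻ z, ENNReal.ofReal (max (v z - M) 0 ^ q) ∂μ)
        + ENNReal.ofReal (M ^ q / l ^ 2) * ∫⁻ z, ENNReal.ofReal (v z ^ 2) ∂μ) := by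
  rw [← lintegral_const_mul' _ _ ENNReal.ofReal_ne_top, ← lintegral_add_left (by fun_prop),
    ← lintegral_const_mul' _ _ ENNReal.ofReal_ne_top]
  refine lintegral_mono fun z => ?_
  rw [← ENNReal.ofReal_mul (by positivity), ← ENNReal.ofReal_add (by positivity) (by positivity),
    ← ENNReal.ofReal_mul (by positivity)]
  exact ENNReal.ofReal_le_ofReal (rpow_truncation_le (hv0 z) hl hM hq)

/-- Above a high level the integral is small because the energy is bounded, below it because the
`L²` norm is small. -/
theorem exists_lintegral_rpow_truncation_le_of_lintegral_sq_le (hd : 1 ≤ d) {q K r R l β : ℝ}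
    (hq : 0 < q) (hq2 : q < 2 + 4 / (d : ℝ)) (hK : 0 < K) (hr : 0 ≤ r) (hrR : r < R)
    (hl : 0 < l) (hβ : 0 < β) :
    ∃ δ : ℝ, 0 < δ ∧ ∀ v : ℝ × 𝔼 → ℝ, HasEnergyBound v R K → (∀ z, 0 ≤ v z) →
      ∫⁻ z in parabolicCylinder d r, ENNReal.ofReal (v z ^ 2) ≤ ENNReal.ofReal δ →
      ∫⁻ z in parabolicCylinder d r, ENNReal.ofReal (max (v z - l) 0 ^ q) ≤ ENNReal.ofReal β := by
  obtain ⟨C, hC, truncation⟩ := exists_lintegral_rpow_truncation_le hd hq hq2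
  have hR : 0 < R := hr.trans_lt hrR
  set Y : ℝ := 2 ^ q * (C * (K ^ (1 + 2 / (d : ℝ)) * (R / (R - r)) ^ 2)) with hY
  have hY0 : 0 < Y := by positivity
  obtain ⟨M, hMβ, hM⟩ := (((tendsto_rpow_neg_atTop (sub_pos.2 hq2)).eventually_lt_const
    (show 0 < β / 2 / Y by positivity)).and (Filter.eventually_gt_atTop 0)).exists
  refine ⟨β / 2 / (2 ^ q * (M ^ q / l ^ 2)), by positivity, fun v h hv0 hsq => ?_⟩
  set δ : ℝ := β / 2 / (2 ^ q * (M ^ q / l ^ 2)) with hδ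
  refine (lintegral_rpow_truncation_le h.measurable hv0 hl hM.le hq).trans
    ((mul_le_mul' le_rfl (add_le_add (truncation v r R K M h hr hrR hK hM)
      (mul_le_mul' le_rfl hsq))).trans ?_)
  rw [← ENNReal.ofReal_mul (by positivity), ← ENNReal.ofReal_add (by positivity) (by positivity),
    ← ENNReal.ofReal_mul (by positivity)]
  refine ENNReal.ofReal_le_ofReal ?_
  calc 2 ^ q * (C * (M ^ (q - 2 - 4 / (d : ℝ)) * K ^ (1 + 2 / (d : ℝ)) * (R / (R - r)) ^ 2)
        + M ^ q / l ^ 2 * δ)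
      = Y * M ^ (-(2 + 4 / (d : ℝ) - q)) + 2 ^ q * (M ^ q / l ^ 2) * δ := by
        rw [hY, show q - 2 - 4 / (d : ℝ) = -(2 + 4 / (d : ℝ) - q) by ring]
        ring
    _ ≤ Y * (β / 2 / Y) + 2 ^ q * (M ^ q / l ^ 2) * δ := by gcongr
    _ = β := by
        rw [hδ, mul_div_cancel₀ _ hY0.ne', mul_div_cancel₀ _ (by positivity), add_halves]

theorem DeGiorgiSubclass.exists_hasEnergyBound_of_lintegral_sq_small (hd : 1 ≤ d)
    (hγ₁ : 0 < γ₁) (hγ₂ : 0 ≤ γ₂) (hγ₃ : 0 ≤ γ₃) (hp : 1 ≤ p) (hp2 : p < 2 + 4 / (d : ℝ))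
    {r l ε : ℝ} (hr : 0 < r) (hr1 : r < 1) (hl : 0 < l) (hε : 0 < ε) :
    ∃ δ : ℝ, 0 < δ ∧ ∀ (u : ℝ × 𝔼 → ℝ) (k : ℝ),
      DeGiorgiSubclass (-1) 0 (Metric.ball 0 1) γ₁ γ₂ γ₃ p u → Measurable u → 0 ≤ k →
      ∫⁻ z in parabolicCylinder d 1, ENNReal.ofReal (max (u z - k) 0 ^ 2) ≤ ENNReal.ofReal δ →
      HasEnergyBound (fun z => max (u z - (k + l)) 0) r ε := by
  have hp0 : 0 < p := by linarith
  obtain ⟨m, hrm, hm1⟩ := exists_between hr1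
  obtain ⟨R, hmR, hR1⟩ := exists_between hm1
  have hm : 0 < m := hr.trans hrm
  set c : ℝ := (1 + 1 / γ₁) * (1 + γ₂ + γ₃) with hc
  have hc0 : 0 < c := by positivity
  obtain ⟨K, hK, bounded⟩ := DeGiorgiSubclass.exists_hasEnergyBound_of_lintegral_sq_le hd
    hγ₁ hγ₂ hγ₃ hp hp2 (hm.trans hmR) hR1 zero_le_one
  obtain ⟨δ, hδ, small⟩ := exists_lintegral_rpow_truncation_le_of_lintegral_sq_le hd hp0 hp2 hK
    hm.le hmR hl (β := (ε / (2 * c)) ^ p) (by positivity)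
  set A : ℝ := ε / (2 * c) * (m - r) ^ 2 with hA
  refine ⟨min 1 (min δ A), by positivity, fun u k hu hum hk hsq => ?_⟩
  have hsq_le {a : ℝ} (ha : min 1 (min δ A) ≤ a) : ∫⁻ z in parabolicCylinder d 1,
      ENNReal.ofReal (max (u z - k) 0 ^ 2) ≤ ENNReal.ofReal a :=
    hsq.trans (ENNReal.ofReal_le_ofReal ha)
  have hsub : parabolicCylinder d m ⊆ parabolicCylinder d 1 :=
    parabolicCylinder_subset hm.le hm1.le
  have hpow := small _ (bounded u k hu hum hk (hsq_le (min_le_left _ _)))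
    (fun z => le_max_right _ _) ((lintegral_mono_set hsub).trans
      (hsq_le ((min_le_right _ _).trans (min_le_left _ _))))
  simp only [max_max_sub_sub _ _ hl.le] at hpow
  have hsqA : ∫⁻ z in parabolicCylinder d m, ENNReal.ofReal (max (u z - (k + l)) 0 ^ 2)
      ≤ ENNReal.ofReal A := by
    refine (lintegral_mono fun z => ENNReal.ofReal_le_ofReal ?_).trans
      ((lintegral_mono_set hsub).trans (hsq_le ((min_le_right _ _).trans (min_le_right _ _))))
    gcongr
    exact le_add_of_nonneg_right hl.le
  refine (hu.hasEnergyBound hum hγ₁ hγ₂ hγ₃ hp0.le hr hrm hm1.le (by positivity) (by positivity)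
    hsqA hpow).mono hr.le le_rfl (le_of_eq ?_)
  rw [← Real.rpow_mul (by positivity), mul_one_div_cancel hp0.ne', Real.rpow_one, ← hc, hA,
    mul_div_cancel_right₀ _ (by positivity)]
  field_simp
  ring

end Smallness

section Iteration

variable {d : ℕ} {γ₁ γ₂ γ₃ p : ℝ}

local notation "𝔼" => EuclideanSpace ℝ (Fin d)

theorem exists_lintegral_rpow_max_sub_add_le (hd : 1 ≤ d) {q : ℝ} (hq : 0 < q)
    (hq2 : q < 2 + 4 / (d : ℝ)) :
    ∃ C : ℝ, 0 < C ∧ ∀ (u : ℝ × 𝔼 → ℝ) (k r h E : ℝ),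
      HasEnergyBound (fun z => max (u z - k) 0) (r + h) E →
      0 ≤ r → 0 < h → r + h ≤ 1 → 0 < E →
      ∫⁻ z in parabolicCylinder d r, ENNReal.ofReal (max (u z - (k + h)) 0 ^ q)
        ≤ ENNReal.ofReal (C * ((1 / h) ^ 8 * E ^ (1 + 2 / (d : ℝ)))) := by
  obtain ⟨C, hC, truncation⟩ := exists_lintegral_rpow_truncation_le hd hq hq2
  refine ⟨C, hC, fun u k r h E hE hr hh hrh hE0 => ?_⟩
  have key := truncation _ r (r + h) E h hE hr (by linarith) hE0 hh
  simp only [max_max_sub_sub _ _ hh.le] at key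
  refine key.trans (ENNReal.ofReal_le_ofReal ?_)
  have hd4 : 4 / (d : ℝ) ≤ 4 := div_le_self (by norm_num) (by exact_mod_cast hd)
  have hpow : h ^ (q - 2 - 4 / (d : ℝ)) ≤ (1 / h) ^ 6 := by
    rw [← Real.rpow_natCast, one_div, Real.inv_rpow hh.le, ← Real.rpow_neg hh.le]
    exact Real.rpow_le_rpow_of_exponent_ge hh (by linarith) (by push_cast; linarith)
  calc C * (h ^ (q - 2 - 4 / (d : ℝ)) * E ^ (1 + 2 / (d : ℝ)) * ((r + h) / (r + h - r)) ^ 2)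
      ≤ C * ((1 / h) ^ 6 * E ^ (1 + 2 / (d : ℝ)) * (1 / h) ^ 2) := by
        rw [add_sub_cancel_left]
        gcongr
    _ = _ := by ring

theorem DeGiorgiSubclass.exists_hasEnergyBound_step (hd : 1 ≤ d)
    (hγ₁ : 0 < γ₁) (hγ₂ : 0 ≤ γ₂) (hγ₃ : 0 ≤ γ₃) (hp : 1 ≤ p) (hp2 : p < 2 + 4 / (d : ℝ)) :
    ∃ D : ℝ, 0 < D ∧ ∀ (u : ℝ × 𝔼 → ℝ) (k r h E : ℝ),
      DeGiorgiSubclass (-1) 0 (Metric.ball 0 1) γ₁ γ₂ γ₃ p u → Measurable u →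
      HasEnergyBound (fun z => max (u z - k) 0) (r + 2 * h) E →
      0 < r → 0 < h → r + 2 * h ≤ 1 → 0 < E → E ≤ 1 →
      HasEnergyBound (fun z => max (u z - (k + h)) 0) r
        (D * ((1 / h) ^ 10 * E ^ ((1 + 2 / (d : ℝ)) / p))) := by
  have hp0 : 0 < p := by linarith
  have hd0 : 0 < 4 / (d : ℝ) := by positivity
  obtain ⟨C₂, hC₂, sq_le⟩ :=
    exists_lintegral_rpow_max_sub_add_le hd (q := 2) two_pos (by linarith)
  obtain ⟨Cp, hCp, pow_le⟩ := exists_lintegral_rpow_max_sub_add_le hd hp0 hp2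
  refine ⟨(1 + 1 / γ₁) * (1 + γ₂ + γ₃) * (C₂ + Cp ^ (1 / p)), by positivity,
    fun u k r h E hu hum hE hr hh hrh hE0 hE1 => ?_⟩
  rw [show r + 2 * h = r + h + h by ring] at hE hrh
  have hsq := sq_le u k (r + h) h E hE (by positivity) hh hrh hE0
  simp only [Real.rpow_two] at hsq
  refine (hu.hasEnergyBound hum hγ₁ hγ₂ hγ₃ hp0.le hr (lt_add_of_pos_right r hh) (by linarith)
    (by positivity) (by positivity) hsq
    (pow_le u k (r + h) h E hE (by positivity) hh hrh hE0)).mono hr.le le_rfl ?_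
  rw [add_sub_cancel_left, mul_assoc _ (C₂ + _), add_mul C₂]
  set F : ℝ := E ^ (1 + 2 / (d : ℝ)) with hF
  set T : ℝ := E ^ ((1 + 2 / (d : ℝ)) / p)
  have hh1 : 1 ≤ 1 / h := (one_le_div hh).2 (by linarith)
  have hFT : F ≤ T := Real.rpow_le_rpow_of_exponent_ge hE0 hE1 (div_le_self (by positivity) hp)
  have hFp : F ^ (1 / p) = T := by rw [hF, ← Real.rpow_mul hE0.le, mul_one_div]
  gcongr
  · calc C₂ * ((1 / h) ^ 8 * F) / h ^ 2 = C₂ * ((1 / h) ^ 10 * F) := by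
          field_simp
      _ ≤ C₂ * ((1 / h) ^ 10 * T) := by gcongr
  · rw [Real.mul_rpow hCp.le (by positivity), Real.mul_rpow (by positivity) (by positivity), hFp]
    gcongr
    calc ((1 / h) ^ 8) ^ (1 / p) ≤ (1 / h) ^ 8 :=
          Real.rpow_le_self_of_one_le (one_le_pow₀ hh1) ((div_le_one hp0).2 hp)
      _ ≤ (1 / h) ^ 10 := pow_le_pow_right₀ hh1 (by norm_num)

theorem exists_geometric_decay {D b β : ℝ} (hD : 0 < D) (hb : 1 < b) (hβ : 0 < β) :
    ∃ E lam : ℝ, 0 < E ∧ 0 < lam ∧ lam < 1 ∧ ∀ P : ℕ → ℝ → Prop,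
      (∀ n e e', e ≤ e' → P n e → P n e') →
      (∀ n e, 0 < e → e ≤ 1 → P n e → P (n + 1) (D * b ^ n * e ^ (1 + β))) →
      P 0 E → ∀ n, P n (E * lam ^ n) := by
  have hb0 : 0 < b := by linarith
  set lam : ℝ := b ^ (-β⁻¹) with hlam
  have hlam0 : 0 < lam := by positivity
  have hlam1 : lam < 1 := Real.rpow_lt_one_of_one_lt_of_neg hb (neg_neg_of_pos (inv_pos.2 hβ))
  have hlamβ : lam ^ β = b⁻¹ := by
    rw [hlam, ← Real.rpow_mul hb0.le, neg_mul, inv_mul_cancel₀ hβ.ne', Real.rpow_neg_one]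
  set E : ℝ := min 1 ((lam / D) ^ β⁻¹)
  have hE0 : 0 < E := by positivity
  have hEβ : D * E ^ β ≤ lam := by
    rw [← le_div_iff₀' hD]
    calc E ^ β ≤ ((lam / D) ^ β⁻¹) ^ β := by gcongr; exact min_le_right _ _
      _ = lam / D := Real.rpow_inv_rpow (by positivity) hβ.ne'
  refine ⟨E, lam, hE0, hlam0, hlam1, fun P mono step h0 n => ?_⟩
  induction n with
  | zero => simpa using h0
  | succ n ih =>
    have hle : E * lam ^ n ≤ 1 :=
      mul_le_one₀ (min_le_left _ _) (by positivity) (pow_le_one₀ hlam0.le hlam1.le)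
    refine mono _ _ _ ?_ (step n _ (by positivity) hle ih)
    have hlam_pow : (lam ^ n) ^ β = (b ^ n)⁻¹ := by
      rw [← Real.rpow_pow_comm hlam0.le, hlamβ, inv_pow]
    rw [Real.rpow_add (by positivity), Real.rpow_one, Real.mul_rpow hE0.le (by positivity),
      hlam_pow]
    calc D * b ^ n * (E * lam ^ n * (E ^ β * (b ^ n)⁻¹))
        = D * E ^ β * (E * lam ^ n) := by field_simp
      _ ≤ lam * (E * lam ^ n) := by gcongr
      _ = E * lam ^ (n + 1) := by ring

theorem ae_le_of_forall_hasEnergyBound {u : ℝ × 𝔼 → ℝ} {k ρ e : ℕ → ℝ} {K r : ℝ}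
    (hr : 0 ≤ r) (hk : ∀ n, k n ≤ K) (hρ : ∀ n, r ≤ ρ n)
    (he : Filter.Tendsto e Filter.atTop (nhds 0)) (hu : Measurable u)
    (h : ∀ n, HasEnergyBound (fun z => max (u z - k n) 0) (ρ n) (e n)) :
    ∀ᵐ z ∂volume.restrict (parabolicCylinder d r), u z ≤ K := by
  have hle (n : ℕ) : ∫⁻ z in parabolicCylinder d r, ENNReal.ofReal (max (u z - K) 0 ^ 2)
      ≤ ENNReal.ofReal (r ^ 2 * e n) := by
    refine (lintegral_mono fun z => ENNReal.ofReal_le_ofReal ?_).trans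
      ((h n).mono hr (hρ n) le_rfl).lintegral_sq_le
    gcongr
    exact hk n
  have hlim : Filter.Tendsto (fun n => ENNReal.ofReal (r ^ 2 * e n)) Filter.atTop (nhds 0) := by
    simpa using ENNReal.tendsto_ofReal (he.const_mul (r ^ 2))
  have hzero : ∫⁻ z in parabolicCylinder d r, ENNReal.ofReal (max (u z - K) 0 ^ 2) = 0 :=
    nonpos_iff_eq_zero.1 (ge_of_tendsto' hlim hle)
  rw [lintegral_eq_zero_iff (by fun_prop)] at hzero
  filter_upwards [hzero] with z hz
  have hmax : max (u z - K) 0 = 0 :=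
    pow_eq_zero_iff two_ne_zero |>.1
      (le_antisymm (ENNReal.ofReal_eq_zero.1 hz) (sq_nonneg _))
  exact sub_nonpos.1 (max_eq_right_iff.1 hmax)

/-- Started from a small energy on `Q_{3/4}` at the level `3/8`, the iteration runs over the levels
`1/2 - 2h` and the radii `1/2 + 4h`, where `h = 2⁻ⁿ/16`. -/
theorem DeGiorgiSubclass.exists_ae_le_half_of_hasEnergyBound (hd : 1 ≤ d)
    (hγ₁ : 0 < γ₁) (hγ₂ : 0 ≤ γ₂) (hγ₃ : 0 ≤ γ₃) (hp : 1 ≤ p) (hp2 : p < 1 + 2 / (d : ℝ)) :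
    ∃ ε : ℝ, 0 < ε ∧ ∀ u : ℝ × 𝔼 → ℝ,
      DeGiorgiSubclass (-1) 0 (Metric.ball 0 1) γ₁ γ₂ γ₃ p u → Measurable u →
      HasEnergyBound (fun z => max (u z - 3 / 8) 0) (3 / 4) ε →
      ∀ᵐ z ∂volume.restrict (parabolicCylinder d (1 / 2)), u z ≤ 1 / 2 := by
  have hexponent : 0 < (1 + 2 / (d : ℝ)) / p - 1 :=
    sub_pos.2 ((one_lt_div (by linarith)).2 hp2)
  have hp3 : p < 2 + 4 / (d : ℝ) :=
    hp2.trans (add_lt_add_of_lt_of_le one_lt_two (by gcongr; norm_num))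
  obtain ⟨D, hD, energy_step⟩ := DeGiorgiSubclass.exists_hasEnergyBound_step hd hγ₁ hγ₂ hγ₃ hp hp3
  obtain ⟨ε, lam, hε, hlam0, hlam1, decay⟩ := exists_geometric_decay
    (show 0 < D * 16 ^ 10 by positivity) (show (1 : ℝ) < 2 ^ 10 by norm_num) hexponent
  refine ⟨ε, hε, fun u hu hum hstart => ?_⟩
  set h : ℕ → ℝ := fun n => 1 / (2 ^ n * 16) with hh
  have hh0 (n : ℕ) : 0 < h n := by positivity
  have hh1 (n : ℕ) : h n ≤ 1 / 16 := by
    simp only [hh]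
    gcongr
    exact le_mul_of_one_le_left (by norm_num) (one_le_pow₀ one_le_two)
  have hhalf (n : ℕ) : h (n + 1) = h n / 2 := by simp only [hh, pow_succ]; field_simp
  refine ae_le_of_forall_hasEnergyBound (k := fun n => 1 / 2 - 2 * h n)
    (ρ := fun n => 1 / 2 + 4 * h n) (by norm_num) (fun n => by linarith [hh0 n])
    (fun n => by linarith [hh0 n])
    (by simpa using (tendsto_pow_atTop_nhds_zero_of_lt_one hlam0.le hlam1).const_mul ε) hum
    (decay (fun n => HasEnergyBound (fun z => max (u z - (1 / 2 - 2 * h n)) 0) (1 / 2 + 4 * h n))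
      (fun n e e' hle he => he.mono (by linarith [hh0 n]) le_rfl hle) ?_ ?_)
  · intro n e he0 he1 he
    have hnext := energy_step u (1 / 2 - 2 * h n) (1 / 2 + 4 * h (n + 1)) (h n) e hu hum
      (by rw [hhalf]; convert he using 1; ring) (by linarith [hh0 (n + 1)]) (hh0 n)
      (by rw [hhalf]; linarith [hh1 n]) he0 he1
    convert hnext using 1
    · funext z
      rw [hhalf]
      ring_nf
    · rw [add_sub_cancel, show 1 / h n = 2 ^ n * 16 from one_div_one_div _, mul_pow,
        pow_right_comm]
      ring
  · norm_num [hh]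
    exact hstart

end Iteration

section Scaling

variable {d : ℕ} {γ₁ γ₂ γ₃ p T₁ T₂ : ℝ} {Ω : Set (EuclideanSpace ℝ (Fin d))}
  {u : ℝ × EuclideanSpace ℝ (Fin d) → ℝ}

local notation "𝔼" => EuclideanSpace ℝ (Fin d)

theorem DeGiorgiSubclass.exists_ae_le_half (hd : 1 ≤ d)
    (hγ₁ : 0 < γ₁) (hγ₂ : 0 ≤ γ₂) (hγ₃ : 0 ≤ γ₃) (hp : 1 ≤ p) (hp2 : p < 1 + 2 / (d : ℝ)) :
    ∃ δ : ℝ, 0 < δ ∧ ∀ u : ℝ × 𝔼 → ℝ,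
      DeGiorgiSubclass (-1) 0 (Metric.ball 0 1) γ₁ γ₂ γ₃ p u →
      ∫⁻ z in parabolicCylinder d 1, ENNReal.ofReal (max (u z) 0 ^ 2) ≤ ENNReal.ofReal δ →
      ∀ᵐ z ∂volume.restrict (parabolicCylinder d (1 / 2)), u z ≤ 1 / 2 := by
  obtain ⟨ε, hε, iteration⟩ :=
    DeGiorgiSubclass.exists_ae_le_half_of_hasEnergyBound hd hγ₁ hγ₂ hγ₃ hp hp2
  obtain ⟨δ, hδ, small⟩ := DeGiorgiSubclass.exists_hasEnergyBound_of_lintegral_sq_small hd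
    hγ₁ hγ₂ hγ₃ hp (hp2.trans (add_lt_add_of_lt_of_le one_lt_two (by gcongr; norm_num)))
    (r := 3 / 4) (l := 3 / 8) (by norm_num) (by norm_num) (by norm_num) hε
  refine ⟨δ, hδ, fun u hu hsq => ?_⟩
  obtain ⟨v, hv, huv⟩ := hu.memLinftyL2.aestronglyMeasurable.aemeasurable
  have hvDG := hu.congr huv
  rw [← parabolicCylinder_one] at huv
  have hvsq : ∫⁻ z in parabolicCylinder d 1, ENNReal.ofReal (max (v z - 0) 0 ^ 2)
      ≤ ENNReal.ofReal δ := by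
    refine (lintegral_congr_ae (huv.mono fun z hz => ?_)).trans_le hsq
    simp only [sub_zero, hz]
  have hstart := small v 0 hvDG hv le_rfl hvsq
  rw [zero_add] at hstart
  filter_upwards [iteration v hvDG hv hstart, ae_restrict_of_ae_restrict_of_subset
    (parabolicCylinder_subset (by norm_num) (by norm_num)) huv] with z hvz huvz
  rwa [huvz]

theorem max_mul_sub_eq {c : ℝ} (hc : 0 < c) (a k : ℝ) :
    max (c * a - k) 0 = c * max (a - k / c) 0 := by
  rw [mul_max_of_nonneg _ _ hc.le, mul_zero, mul_sub, mul_div_cancel₀ _ hc.ne']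

/-- For `c ≤ 1`, the quadratic terms scale by `c²` and the `Lᵖ` term by `c ≥ c²`. -/
theorem EnergyInequality.const_mul {k c : ℝ} {G : ℝ × 𝔼 → 𝔼} {x₀ : 𝔼} {r R s t : ℝ}
    (h : EnergyInequality γ₁ γ₂ γ₃ p u (k / c) G x₀ r R s t) (hp : 0 < p)
    (hc : 0 < c) (hc1 : c ≤ 1) :
    EnergyInequality γ₁ γ₂ γ₃ p (fun z => c * u z) k (fun z => c • G z) x₀ r R s t := by
  have hsq (z) : ENNReal.ofReal (max (c * u z - k) 0 ^ 2)
      = ENNReal.ofReal (c ^ 2) * ENNReal.ofReal (max (u z - k / c) 0 ^ 2) := by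
    rw [max_mul_sub_eq hc, mul_pow, ENNReal.ofReal_mul (by positivity)]
  have hpow (z) : ENNReal.ofReal (max (c * u z - k) 0 ^ p)
      = ENNReal.ofReal (c ^ p) * ENNReal.ofReal (max (u z - k / c) 0 ^ p) := by
    rw [max_mul_sub_eq hc, Real.mul_rpow hc.le (le_max_right _ _),
      ENNReal.ofReal_mul (by positivity)]
  have hgrad (z) : ENNReal.ofReal (‖c • G z‖ ^ 2)
      = ENNReal.ofReal (c ^ 2) * ENNReal.ofReal (‖G z‖ ^ 2) := by
    rw [norm_smul, Real.norm_of_nonneg hc.le, mul_pow, ENNReal.ofReal_mul (by positivity)]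
  have hroot : ENNReal.ofReal (c ^ p) ^ (1 / p) = ENNReal.ofReal c := by
    rw [ENNReal.ofReal_rpow_of_nonneg (by positivity) (by positivity), one_div,
      Real.rpow_rpow_inv hc.le hp.ne']
  have hsq_le : ENNReal.ofReal (c ^ 2) ≤ ENNReal.ofReal c :=
    ENNReal.ofReal_le_ofReal (pow_le_of_le_one hc.le hc1 two_ne_zero)
  unfold EnergyInequality at h ⊢
  simp only [hsq, hpow, hgrad, lintegral_const_mul' _ _ ENNReal.ofReal_ne_top,
    ENNReal.mul_rpow_of_nonneg _ _ (one_div_nonneg.2 hp.le), hroot]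
  refine le_trans (le_of_eq ?_) ((mul_le_mul' (le_refl (ENNReal.ofReal (c ^ 2))) h).trans ?_)
  · ring
  · rw [mul_add, mul_add, mul_left_comm _ (ENNReal.ofReal γ₃),
      mul_left_comm _ (ENNReal.ofReal (γ₂ / (R - r) ^ 2))]
    gcongr

theorem DeGiorgiSubclass.const_mul (h : DeGiorgiSubclass T₁ T₂ Ω γ₁ γ₂ γ₃ p u) (hp : 0 < p)
    {c : ℝ} (hc : 0 < c) (hc1 : c ≤ 1) :
    DeGiorgiSubclass T₁ T₂ Ω γ₁ γ₂ γ₃ p (fun z => c * u z) := by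
  obtain ⟨M, hM⟩ := h.memLinftyL2.bounded
  obtain ⟨G, hG⟩ := h.exists_gradient
  refine ⟨⟨h.memLinftyL2.aestronglyMeasurable.const_mul c, M, ?_⟩, ⟨_, hG.const_mul c⟩,
    fun k => ?_⟩
  · filter_upwards [hM] with t ht
    refine (eLpNorm_mono fun x => ?_).trans ht
    rw [norm_mul, Real.norm_of_nonneg hc.le]
    exact mul_le_of_le_one_left (norm_nonneg _) hc1
  · obtain ⟨Gk, hGk, henergy⟩ := h.energy (k / c)
    refine ⟨fun z => c • Gk z, ?_, fun r R x₀ hr hrR hx₀ hball => ?_⟩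
    · simpa only [max_mul_sub_eq hc] using hGk.const_mul c
    · filter_upwards [henergy r R x₀ hr hrR hx₀ hball] with s hs
      filter_upwards [hs] with t ht hst
      exact (ht hst).const_mul hp hc hc1

/-- The smallness statement is applied to `u / lam` with `lam = 1 + ‖u₊‖₂ / √δ`; the summand `1`
keeps the factor `1 / lam` in the range `(0, 1]` in which the class is stable under scaling. -/
theorem DeGiorgiSubclass.eLpNorm_top_le_of_smallness {Q Q' : Set (ℝ × 𝔼)} {δ : ℝ}
    (hu : DeGiorgiSubclass T₁ T₂ Ω γ₁ γ₂ γ₃ p u) (hp : 0 < p) (hδ : 0 < δ)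
    (smallness : ∀ u : ℝ × 𝔼 → ℝ, DeGiorgiSubclass T₁ T₂ Ω γ₁ γ₂ γ₃ p u →
      ∫⁻ z in Q, ENNReal.ofReal (max (u z) 0 ^ 2) ≤ ENNReal.ofReal δ →
      ∀ᵐ z ∂volume.restrict Q', max (u z) 0 ≤ 1 / 2) :
    eLpNorm (fun z => max (u z) 0) ⊤ (volume.restrict Q') ≤
      ENNReal.ofReal (1 + 1 / √δ) *
        (eLpNorm (fun z => max (u z) 0) 2 (volume.restrict Q) + 1) := by
  have hδ' : 0 < √δ := Real.sqrt_pos.2 hδ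
  rcases eq_or_ne (eLpNorm (fun z => max (u z) 0) 2 (volume.restrict Q)) ⊤ with htop | htop
  · rw [htop, top_add, ENNReal.mul_top (ENNReal.ofReal_pos.2 (by positivity)).ne']
    exact le_top
  obtain ⟨N, hN0, hN⟩ : ∃ N : ℝ, 0 ≤ N ∧
      eLpNorm (fun z => max (u z) 0) 2 (volume.restrict Q) = ENNReal.ofReal N :=
    ⟨_, ENNReal.toReal_nonneg, (ENNReal.ofReal_toReal htop).symm⟩
  set lam : ℝ := 1 + N / √δ with hlam
  have hlam1 : 1 ≤ lam := le_add_of_nonneg_right (by positivity)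
  have hlam0 : 0 < lam := one_pos.trans_le hlam1
  have hmax (z) : max (lam⁻¹ * u z) 0 = lam⁻¹ * max (u z) 0 := by
    simpa using max_mul_sub_eq (inv_pos.2 hlam0) (u z) 0
  have hsmall : ∫⁻ z in Q, ENNReal.ofReal (max (lam⁻¹ * u z) 0 ^ 2) ≤ ENNReal.ofReal δ := by
    have hNlam : lam⁻¹ * N ≤ √δ := by
      rw [inv_mul_le_iff₀ hlam0, hlam, add_mul, div_mul_cancel₀ _ hδ'.ne']
      linarith
    simp only [hmax, mul_pow, ENNReal.ofReal_mul (sq_nonneg lam⁻¹)]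
    rw [lintegral_const_mul' _ _ ENNReal.ofReal_ne_top, ← eLpNorm_two_sq_eq_lintegral, hN,
      ← ENNReal.ofReal_pow hN0, ← ENNReal.ofReal_mul (by positivity), ← mul_pow]
    exact ENNReal.ofReal_le_ofReal ((Real.le_sqrt (by positivity) hδ.le).1 hNlam)
  have hbound : ∀ᵐ z ∂volume.restrict Q', ‖max (u z) 0‖ ≤ lam / 2 := by
    filter_upwards [smallness _ (hu.const_mul hp (inv_pos.2 hlam0) (inv_le_one_of_one_le₀ hlam1))
      hsmall] with z hz
    rw [hmax, inv_mul_le_iff₀ hlam0] at hz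
    rw [Real.norm_of_nonneg (le_max_right _ _)]
    linarith
  rw [eLpNorm_exponent_top, hN, ← ENNReal.ofReal_one, ← ENNReal.ofReal_add hN0 zero_le_one,
    ← ENNReal.ofReal_mul (by positivity)]
  refine (eLpNormEssSup_le_of_ae_bound hbound).trans (ENNReal.ofReal_le_ofReal ?_)
  calc lam / 2 ≤ lam := half_le_self hlam0.le
    _ ≤ lam + (N + 1 / √δ) := le_add_of_nonneg_right (by positivity)
    _ = (1 + 1 / √δ) * (N + 1) := by rw [hlam]; ring

end Scaling

theorem lemma3p8_general (d : ℕ) (hd : 1 ≤ d) (γ₁ γ₂ γ₃ p : ℝ)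
    (hγ₁ : 0 < γ₁) (hγ₂ : 0 ≤ γ₂) (hγ₃ : 0 ≤ γ₃)
    (hp₁ : 1 ≤ p) (hp₂ : p < ((d : ℝ) + 2) / (d : ℝ)) :
    (∃ δ : ℝ, 0 < δ ∧ ∀ u : ℝ × EuclideanSpace ℝ (Fin d) → ℝ,
      DeGiorgiSubclass (-1) 0 (Metric.ball 0 1) γ₁ γ₂ γ₃ p u →
      (∫⁻ z in parabolicCylinder d 1, ENNReal.ofReal (max (u z) 0 ^ 2)) ≤ ENNReal.ofReal δ →
      ∀ᵐ z ∂(volume.restrict (parabolicCylinder d (1 / 2))), max (u z) 0 ≤ 1 / 2) ∧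
    (∃ C : ℝ, 0 < C ∧ ∀ u : ℝ × EuclideanSpace ℝ (Fin d) → ℝ,
      DeGiorgiSubclass (-1) 0 (Metric.ball 0 1) γ₁ γ₂ γ₃ p u →
      eLpNorm (fun z => max (u z) 0) ∞ (volume.restrict (parabolicCylinder d (1 / 2))) ≤
        ENNReal.ofReal C *
          (eLpNorm (fun z => max (u z) 0) 2 (volume.restrict (parabolicCylinder d 1)) + 1)) := by
  have hd0 : (d : ℝ) ≠ 0 := by exact_mod_cast (Nat.one_le_iff_ne_zero.1 hd)
  rw [add_div, div_self hd0] at hp₂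
  obtain ⟨δ, hδ, le_half⟩ := DeGiorgiSubclass.exists_ae_le_half hd hγ₁ hγ₂ hγ₃ hp₁ hp₂
  have smallness (u : ℝ × EuclideanSpace ℝ (Fin d) → ℝ)
      (hu : DeGiorgiSubclass (-1) 0 (Metric.ball 0 1) γ₁ γ₂ γ₃ p u)
      (hsq : ∫⁻ z in parabolicCylinder d 1, ENNReal.ofReal (max (u z) 0 ^ 2) ≤ ENNReal.ofReal δ) :
      ∀ᵐ z ∂volume.restrict (parabolicCylinder d (1 / 2)), max (u z) 0 ≤ 1 / 2 :=
    (le_half u hu hsq).mono fun z hz => max_le hz (by norm_num)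
  exact ⟨⟨δ, hδ, smallness⟩, 1 + 1 / √δ, by positivity,
    fun u hu => hu.eLpNorm_top_le_of_smallness (by linarith) hδ smallness⟩

theorem lemma3p8 (d : ℕ) (hd : 1 ≤ d) (γ₁ γ₂ γ₃ p : ℝ)
    (hγ₁ : 0 < γ₁) (hγ₂ : 0 < γ₂) (hγ₃ : 0 < γ₃)
    (hp₁ : 1 ≤ p) (hp₂ : p < ((d : ℝ) + 2) / (d : ℝ)) :
    (∃ δ : ℝ, 0 < δ ∧ ∀ u : ℝ × EuclideanSpace ℝ (Fin d) → ℝ,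
      DeGiorgiSubclass (-4) 0 (Metric.ball 0 2) γ₁ γ₂ γ₃ p u →
      (∫⁻ z in parabolicCylinder d 1, ENNReal.ofReal (max (u z) 0 ^ 2)) ≤ ENNReal.ofReal δ →
      ∀ᵐ z ∂(volume.restrict (parabolicCylinder d (1 / 2))), max (u z) 0 ≤ 1 / 2) ∧
    (∃ C : ℝ, 0 < C ∧ ∀ u : ℝ × EuclideanSpace ℝ (Fin d) → ℝ,
      DeGiorgiSubclass (-4) 0 (Metric.ball 0 2) γ₁ γ₂ γ₃ p u →
      eLpNorm (fun z => max (u z) 0) ∞ (volume.restrict (parabolicCylinder d (1 / 2))) ≤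
        ENNReal.ofReal C *
          (eLpNorm (fun z => max (u z) 0) 2 (volume.restrict (parabolicCylinder d 1)) + 1)) := by
  obtain ⟨⟨δ, hδ, hsmall⟩, C, hC, hbound⟩ :=
    lemma3p8_general d hd γ₁ γ₂ γ₃ p hγ₁ hγ₂.le hγ₃.le hp₁ hp₂
  have restrict (u : ℝ × EuclideanSpace ℝ (Fin d) → ℝ)
      (hu : DeGiorgiSubclass (-4) 0 (Metric.ball 0 2) γ₁ γ₂ γ₃ p u) :
      DeGiorgiSubclass (-1) 0 (Metric.ball 0 1) γ₁ γ₂ γ₃ p u :=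
    hu.mono measurableSet_ball (by norm_num) le_rfl (Metric.ball_subset_ball one_le_two)
  exact ⟨⟨δ, hδ, fun u hu => hsmall u (restrict u hu)⟩, C, hC, fun u hu => hbound u (restrict u hu)⟩
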